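/- For $n\ge 1$ let $\mathcal M_n([0,\infty))\subset\mathbb R^n$ be the set of all vectors $(m_1(\mu),\dots,m_n(\mu))$ of the first $n$ moments $m_i(\mu)=\int x^i\,d\mu(x)$ of probability measures $\mu$ on $[0,\infty)$ with finite moments up to order $n$. For $\vec m_n=(m_1,\dots,m_n)\in\mathcal M_n([0,\infty))$ and $1\le k\le n$ let $$m_k^-=\min\Big\{m_k(\mu)\ :\ \mu \text{ a probability measure on } [0,\infty),\ \int x^i\,d\mu(x)=m_i \text{ for } 1\le i\le k-1\Big\},$$ put $m_0=1$, $m_0^-=0$, and, if $m_i>m_i^-$ for $1\le i\le n$, let $z_k(\vec m_n)=\frac{m_k-m_k^-}{m_{k-1}-m_{k-1}^-}$. For real $\gamma_k>-1$ and $\delta_k>0$ let $$g_n^{(\gamma,\delta)}(\vec m_n)=\prod_{k=1}^n\frac{\delta_k^{\gamma_k+n-k+1}}{\Gamma(\gamma_k+n-k+1)}\;\prod_{k=1}^n z_k(\vec m_n)^{\gamma_k}e^{-\delta_k z_k(\vec m_n)}$$ if $\vec m_n\in\mathcal M_n([0,\infty))$ and $m_k>m_k^-$ for all $1\le k\le n$,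 and $g_n^{(\gamma,\delta)}=0$ elsewhere; this is a probability density with respect to Lebesgue measure on $\mathbb R^n$. **Theorem.** Let $(\gamma_k)_{k\ge1}$ be a fixed sequence of real numbers with $\gamma_k>-1$. For each $n$ let $\vec m_n$ be a random vector whose law has density $g_n^{(\gamma,\delta)}$ with $\delta_1=\dots=\delta_n=n$. Fix $k$, and for $n\ge k$ let $\vec m_k^{(n)}$ be the vector of the first $k$ coordinates of $\vec m_n$. Then $$\sqrt n\,C^{-1}\big(\vec m_k^{(n)}-\vec m_k(\eta)\big)\longrightarrow \mathcal N_k(0,I_k)\quad\text{in distribution as } n\to\infty.$$ Here $\vec m_k(\eta)$ is the vector of the first $k$ moments of the Marchenko–Pastur distribution $d\eta(x)=\frac{\sqrt{x(4-x)}}{2\pi x}\mathbf 1_{\{0<x<4\}}\,dx$; these moments are finite and equal to the Catalan numbers, $\vec m_k(\eta)=(c_1,\dots,c_k)$ with $c_i=\frac1{i+1}\binom{2i}{i}$. The matrix $C=(c_{i,j})_{1\le i,j\le k}$ is lower triangular with $c_{i,i}=1$ and $c_{i,j}=\binom{2i}{i-j}-\binom{2i}{i-j-1}$ for $j<i$.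 -/

import Mathlib

open MeasureTheory ProbabilityTheory

noncomputable section

/-- `μ` is a probability measure on `[0, ∞)` with finite moments up to order `k`, and for
`1 ≤ i ≤ k` its `i`-th moment is `c i`. (The value `c 0` plays no role.) -/
def HasMoments (μ : Measure ℝ) (k : ℕ) (c : ℕ → ℝ) : Prop :=
  IsProbabilityMeasure μ ∧ μ (Set.Iio 0) = 0 ∧
    ∀ i ∈ Finset.Icc 1 k, Integrable (fun x : ℝ => x ^ i) μ ∧ ∫ x, x ^ i ∂μ = c i

/-- The vector `(m₁, …, mₙ)`, stored with indices `0, …, n - 1`, read as the sequence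
`m₀ = 1, m₁, …, mₙ` (and `0` beyond `n`). -/
def momentSeq {n : ℕ} (m : Fin n → ℝ) : ℕ → ℝ
  | 0 => 1
  | k + 1 => if h : k < n then m ⟨k, h⟩ else 0

/-- The moment space `𝓜ₙ([0, ∞))`. -/
def momentSpace (n : ℕ) : Set (Fin n → ℝ) :=
  {m | ∃ μ : Measure ℝ, HasMoments μ n (momentSeq m)}

/-- The lower bound `mₖ⁻` : the least `k`-th moment of a probability measure on `[0, ∞)` whose
moments of orders `1, …, k - 1` are `c 1, …, c (k - 1)`; by convention `m₀⁻ = 0`. -/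
def lowerMoment (c : ℕ → ℝ) : ℕ → ℝ
  | 0 => 0
  | k + 1 => sInf {y | ∃ μ : Measure ℝ, HasMoments μ k c ∧
      Integrable (fun x : ℝ => x ^ (k + 1)) μ ∧ ∫ x, x ^ (k + 1) ∂μ = y}

/-- `zₖ = (mₖ - mₖ⁻) / (mₖ₋₁ - mₖ₋₁⁻)` for `k ≥ 1`. -/
def recursionVar (c : ℕ → ℝ) (k : ℕ) : ℝ :=
  (c k - lowerMoment c k) / (c (k - 1) - lowerMoment c (k - 1))

open Classical in
/-- The function `gₙ^(γ,δ)` on the moment space `𝓜ₙ([0, ∞))`, extended by `0` to `ℝⁿ`. The parameters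
are the values `γ k`, `δ k` for `1 ≤ k ≤ n`. -/
def momentDensity (n : ℕ) (γ δ : ℕ → ℝ) (m : Fin n → ℝ) : ℝ :=
  if m ∈ momentSpace n ∧
      ∀ k ∈ Finset.Icc 1 n, lowerMoment (momentSeq m) k < momentSeq m k then
    (∏ k ∈ Finset.Icc 1 n,
        δ k ^ (γ k + (n : ℝ) - (k : ℝ) + 1) / Real.Gamma (γ k + (n : ℝ) - (k : ℝ) + 1)) *
      ∏ k ∈ Finset.Icc 1 n, recursionVar (momentSeq m) k ^ γ k *
        Real.exp (-δ k * recursionVar (momentSeq m) k)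
  else 0

/-- The law on `ℝⁿ` with Lebesgue density `gₙ^(γ,δ)`. -/
def momentLaw (n : ℕ) (γ δ : ℕ → ℝ) : Measure (Fin n → ℝ) :=
  volume.withDensity fun m => ENNReal.ofReal (momentDensity n γ δ m)

/-- The Marchenko–Pastur distribution, with density `√(x (4 - x)) / (2 π x)` on `(0, 4)`. -/
def marchenkoPastur : Measure ℝ :=
  volume.withDensity fun x => ENNReal.ofReal
    ((Set.Ioo (0 : ℝ) 4).indicator (fun x => √(x * (4 - x)) / (2 * Real.pi * x)) x)

/-- The vector of the first `k` moments of the Marchenko–Pastur distribution. -/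
def marchenkoPasturMoments (k : ℕ) : Fin k → ℝ :=
  fun i => ∫ x, x ^ ((i : ℕ) + 1) ∂marchenkoPastur

/-- The projection of a vector of length `n` to its first `k` coordinates. It is used for `k ≤ n`;
for `k > n` the vector is padded with zeros. -/
def firstCoords (k : ℕ) {n : ℕ} (m : Fin n → ℝ) : Fin k → ℝ :=
  fun i => if h : (i : ℕ) < n then m ⟨i, h⟩ else 0

/-- The lower triangular matrix `C` with unit diagonal and, in indices starting at `1`, entries
`binom(2i, i - j) - binom(2i, i - j - 1)` for `j < i`. -/
def matrixC (k : ℕ) : Matrix (Fin k) (Fin k) ℝ :=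
  fun i j =>
    if j = i then 1
    else if j < i then
      (Nat.choose (2 * ((i : ℕ) + 1)) ((i : ℕ) - j) : ℝ)
        - (Nat.choose (2 * ((i : ℕ) + 1)) ((i : ℕ) - j - 1) : ℝ)
    else 0

end

open Filter
open scoped Topology

/-! The proof passes from moments to the coordinates `z_k`. By Stieltjes' continued fraction, `m_i`
is the weighted count of Dyck paths of length `2i`, a down step from `j + 1` to `j` having weight `z
j` (indices start at 0). Among these paths only the one with a single peak of height `i` uses the
weight `z (i - 1)`, so `m_i` is affine in it, with slope the product of the earlier weights. Setting
that weight to zero gives exactly `m_i^-`: the value is attained by a spectral measure of a finite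
Jacobi matrix (`exists_hasMoments_stieltjesMoment`), and it is a lower bound because the square of
an orthogonal polynomial has nonnegative integral (`stieltjesMoment_le_integral`). Hence the weights
are the `z_k` of the statement, and they parametrise the region `m_k > m_k^-` by the positive
orthant.

This parametrisation has a triangular Jacobian, whose determinant raises the exponents `γ_k` to `γ_k
+ n - k`. Under the given density the `z_k` are therefore independent gamma variables
(`momentLaw_eq_map_pi_gammaMeasure`). With rate `n`, each `√n (z_k - 1)` is asymptotically standard
normal (`tendsto_charFun_gammaMeasure`).

A delta method at `z = 1` finishes the proof. There the path counts are the Catalan numbers, which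
are the Marchenko–Pastur moments, and the derivative, computed by reflection, is `C`. Instead of a
Taylor remainder there is an exact identity `m - m(η) = Q(y) y` with `y = z - 1`, `Q` continuous and
`Q(0) = C`. The normalised fluctuation is thus a fixed continuous function of `√n y` and `1/√n`, and
continuous mapping applies. -/

/-! ### Weighted paths and Stieltjes moments. -/

/-- The total weight of the lattice paths with steps `±1` that stay nonnegative and go from `0` to
`h` in `i` steps, where a step from `j + 1` down to `j` has weight `z j`. -/
def pathWeight (z : ℕ → ℝ) : ℕ → ℕ → ℝ
  | 0, h => if h = 0 then 1 else 0
  | i + 1, 0 => z 0 * pathWeight z i 1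
  | i + 1, h + 1 => pathWeight z i h + z (h + 1) * pathWeight z i (h + 2)

/-- The moments whose Stieltjes continued fraction has the coefficients `z`. -/
def stieltjesMoment (z : ℕ → ℝ) (i : ℕ) : ℝ := pathWeight z (2 * i) 0

lemma pathWeight_zero_zero (z : ℕ → ℝ) : pathWeight z 0 0 = 1 := by simp [pathWeight]

lemma pathWeight_zero_succ (z : ℕ → ℝ) (h : ℕ) : pathWeight z 0 (h + 1) = 0 := by
  simp [pathWeight]

lemma pathWeight_succ_zero (z : ℕ → ℝ) (i : ℕ) :
    pathWeight z (i + 1) 0 = z 0 * pathWeight z i 1 := rfl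

lemma pathWeight_succ_succ (z : ℕ → ℝ) (i h : ℕ) :
    pathWeight z (i + 1) (h + 1) = pathWeight z i h + z (h + 1) * pathWeight z i (h + 2) := rfl

lemma stieltjesMoment_zero (z : ℕ → ℝ) : stieltjesMoment z 0 = 1 := by
  simp [stieltjesMoment, pathWeight]

lemma pathWeight_eq_zero_of_lt (z : ℕ → ℝ) (i h : ℕ) (hih : i < h) : pathWeight z i h = 0 := by
  induction i generalizing h with
  | zero =>
    obtain ⟨h, rfl⟩ := Nat.exists_eq_succ_of_ne_zero hih.ne'
    exact pathWeight_zero_succ z h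
  | succ i ih =>
    obtain ⟨h, rfl⟩ := Nat.exists_eq_succ_of_ne_zero (Nat.ne_zero_of_lt hih)
    rw [Nat.succ_eq_add_one, pathWeight_succ_succ, ih h (by omega), ih (h + 2) (by omega)]
    simp

lemma pathWeight_self (z : ℕ → ℝ) (i : ℕ) : pathWeight z i i = 1 := by
  induction i with
  | zero => exact pathWeight_zero_zero z
  | succ i ih =>
    rw [pathWeight_succ_succ, ih, pathWeight_eq_zero_of_lt z i (i + 2) (by omega)]
    simp

lemma pathWeight_eq_zero_of_odd (z : ℕ → ℝ) (i h : ℕ) (hih : Odd (i + h)) :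
    pathWeight z i h = 0 := by
  induction i generalizing h with
  | zero =>
    rcases h with _ | h
    · simp at hih
    · exact pathWeight_zero_succ z h
  | succ i ih =>
    rcases h with _ | h
    · rw [pathWeight_succ_zero, ih 1 (by simpa using hih), mul_zero]
    · rw [pathWeight_succ_succ, ih h (by grind), ih (h + 2) (by grind)]
      simp

/-- A path that visits height `j + 1` and ends at `h` needs at least `(j + 1) + (j + 1 - h)` steps,
so the other weights are never used. -/
lemma pathWeight_congr {z z' : ℕ → ℝ} (i h : ℕ)
    (hz : ∀ j, 2 * (j + 1) ≤ i + h → z j = z' j) : pathWeight z i h = pathWeight z' i h := by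
  induction i generalizing h with
  | zero => rcases h with _ | h <;> simp [pathWeight]
  | succ i ih =>
    rcases h with _ | h
    · rw [pathWeight_succ_zero, pathWeight_succ_zero, ih 1 (fun j hj => hz j (by omega))]
      rcases i with _ | i
      · simp [pathWeight_zero_succ]
      · rw [hz 0 (by omega)]
    · rw [pathWeight_succ_succ, pathWeight_succ_succ, ih h (fun j hj => hz j (by omega)),
        ih (h + 2) (fun j hj => hz j (by omega))]
      by_cases hi : i < h + 2
      · simp [pathWeight_eq_zero_of_lt _ i (h + 2) hi]
      · rw [hz (h + 1) (by omega)]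

lemma stieltjesMoment_congr {z z' : ℕ → ℝ} (i : ℕ) (hz : ∀ j < i, z j = z' j) :
    stieltjesMoment z i = stieltjesMoment z' i :=
  pathWeight_congr _ _ fun j hj => hz j (by omega)

/-- With `i + h = 2 (k + 1)`, a path can only just reach height `k + 1`: it must climb straight up
and then descend straight to `h`. This single path contributes the product; all others avoid the
weight `z k`. -/
lemma pathWeight_eq_update_add_prod (z : ℕ → ℝ) (k i h : ℕ) (hk : h ≤ k)
    (hih : i + h = 2 * (k + 1)) :
    pathWeight z i h =
      pathWeight (Function.update z k 0) i h + ∏ j ∈ Finset.Ico h (k + 1), z j := by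
  induction i generalizing h with
  | zero => omega
  | succ i ih =>
    have step : ∀ g, h = g → z g * pathWeight z i (g + 1) =
        Function.update z k 0 g * pathWeight (Function.update z k 0) i (g + 1) +
          ∏ j ∈ Finset.Ico g (k + 1), z j := by
      rintro g rfl
      rw [Finset.prod_eq_prod_Ico_succ_bot (by omega)]
      rcases hk.eq_or_lt with rfl | hlt
      · obtain rfl : i = h + 1 := by omega
        simp [pathWeight_self]
      · rw [Function.update_of_ne hlt.ne, ih (h + 1) (by omega) (by omega), mul_add]
    rcases h with _ | h
    · rw [pathWeight_succ_zero, pathWeight_succ_zero, step 0 rfl]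
    · rw [pathWeight_succ_succ, pathWeight_succ_succ, step (h + 1) rfl,
        pathWeight_congr (z := z) (z' := Function.update z k 0) i h, ← add_assoc]
      intro j hj
      rw [Function.update_of_ne (by omega)]

lemma stieltjesMoment_succ_eq (z : ℕ → ℝ) (k : ℕ) :
    stieltjesMoment z (k + 1) =
      stieltjesMoment (Function.update z k 0) (k + 1) + ∏ j ∈ Finset.range (k + 1), z j := by
  rw [stieltjesMoment, pathWeight_eq_update_add_prod z k _ 0 (by omega) (by omega),
    Finset.range_eq_Ico]
  rfl

/-! ### Unit weights: reflection and Catalan numbers. -/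

/-- The number of walks on `ℤ` with `i` steps `±1` from `0` to `x`. -/
def walkCount : ℕ → ℤ → ℝ
  | 0, x => if x = 0 then 1 else 0
  | i + 1, x => walkCount i (x - 1) + walkCount i (x + 1)

lemma walkCount_succ (i : ℕ) (x : ℤ) :
    walkCount (i + 1) x = walkCount i (x - 1) + walkCount i (x + 1) := rfl

lemma walkCount_neg (i : ℕ) (x : ℤ) : walkCount i (-x) = walkCount i x := by
  induction i generalizing x with
  | zero => simp [walkCount]
  | succ i ih =>
    rw [walkCount_succ, walkCount_succ, ← ih (-x - 1), ← ih (-x + 1), add_comm]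
    congr 2 <;> ring

lemma walkCount_eq_zero (i : ℕ) (x : ℤ) (hx : (i : ℤ) < x) : walkCount i x = 0 := by
  induction i generalizing x with
  | zero => simp at hx; simp [walkCount, hx.ne']
  | succ i ih =>
    push_cast at hx
    rw [walkCount_succ, ih _ (by omega), ih _ (by omega), add_zero]

lemma walkCount_sub_two_mul (i r : ℕ) : walkCount i (i - 2 * r) = i.choose r := by
  induction i generalizing r with
  | zero => rcases r with _ | r <;> simp [walkCount]; omega
  | succ i ih =>
    rw [walkCount_succ]
    rcases r with _ | r
    · rw [walkCount_eq_zero i (_ + 1) (by push_cast; omega), add_zero]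
      have := ih 0
      rw [Nat.choose_zero_right] at this ⊢
      rw [← this]
      congr 1
      push_cast
      ring
    · rw [Nat.choose_succ_succ, Nat.succ_eq_add_one, Nat.cast_add (i.choose r), ← ih r,
        ← ih (r + 1), add_comm]
      congr 2 <;> push_cast <;> ring

/-- Reflection principle: the right side obeys the free walk recursion and, by symmetry of the walk,
vanishes at height `-1`. -/
lemma pathWeight_one (i h : ℕ) :
    pathWeight (fun _ => 1) i h = walkCount i h - walkCount i (h + 2) := by
  induction i generalizing h with
  | zero => 
    rcases h with _ | h
    · simp [pathWeight, walkCount]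
    · simp only [pathWeight, walkCount]
      rw [if_neg (by omega), if_neg (by omega), if_neg (by omega), sub_zero]
  | succ i ih =>
    rcases h with _ | h
    · rw [pathWeight_succ_zero, ih, walkCount_succ, walkCount_succ]
      have := walkCount_neg i 1
      norm_num at this ⊢
      rw [this]
      ring
    · rw [pathWeight_succ_succ, ih, ih, walkCount_succ, walkCount_succ]
      push_cast
      ring_nf

lemma stieltjesMoment_one (i : ℕ) : stieltjesMoment (fun _ => 1) (i + 1) = catalan (i + 1) := by
  rw [stieltjesMoment, pathWeight_one]
  have h1 := walkCount_sub_two_mul (2 * (i + 1)) (i + 1)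
  have h2 := walkCount_sub_two_mul (2 * (i + 1)) i
  push_cast at h1 h2 ⊢
  rw [show (2 * ((i : ℤ) + 1) - 2 * (i + 1)) = 0 by ring] at h1
  rw [show (2 * ((i : ℤ) + 1) - 2 * i) = 2 by ring] at h2
  rw [h1, h2]
  have h3 := succ_mul_catalan_eq_centralBinom (i + 1)
  have h4 := Nat.choose_succ_right_eq (2 * (i + 1)) i
  rw [Nat.centralBinom] at h3
  rw [show 2 * (i + 1) - i = i + 2 by omega] at h4
  have h3' : ((i : ℝ) + 2) * catalan (i + 1) = (2 * (i + 1)).choose (i + 1) := by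
    rw [← h3]; push_cast; ring
  have h4' : ((2 * (i + 1)).choose (i + 1) : ℝ) * (i + 1) = (2 * (i + 1)).choose i * (i + 2) := by
    exact_mod_cast h4
  have h5 : ((i : ℝ) + 2) ≠ 0 := by positivity
  apply mul_left_cancel₀ h5
  linarith

/-! ### Exact linearisation at unit weights. -/

/-- The coefficient of `y j` in the difference quotient of `pathWeight` at the constant
weights `1` in direction `y`. -/
def pathQuotient (j : ℕ) (y : ℕ → ℝ) : ℕ → ℕ → ℝ
  | 0, _ => 0
  | i + 1, 0 => (1 + y 0) * pathQuotient j y i 1 +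
      if j = 0 then pathWeight (fun _ => 1) i 1 else 0
  | i + 1, h + 1 => pathQuotient j y i h + (1 + y (h + 1)) * pathQuotient j y i (h + 2) +
      if j = h + 1 then pathWeight (fun _ => 1) i (h + 2) else 0

/-- Discrete product rule `(1 + y) W' - W = (1 + y) (W' - W) + y W`: the source term carries the
unit-weight count, the rest is recursive. No remainder is left over. -/
lemma pathWeight_one_add_sub (y : ℕ → ℝ) (i h : ℕ) (k : ℕ) (hy : ∀ j, k ≤ j → y j = 0) :
    pathWeight (fun j => 1 + y j) i h - pathWeight (fun _ => 1) i h =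
      ∑ j ∈ Finset.range k, pathQuotient j y i h * y j := by
  have key (g : ℕ) (a : ℝ) : ∑ j ∈ Finset.range k, (if j = g then a else 0) * y j = a * y g := by
    simp only [ite_mul, zero_mul, Finset.sum_ite_eq', Finset.mem_range]
    split_ifs with hg
    · rfl
    · rw [hy g (by omega), mul_zero]
  induction i generalizing h with
  | zero => simp [pathWeight, pathQuotient]
  | succ i ih =>
    rcases h with _ | h
    · simp only [pathQuotient, add_mul _ _ (y _), Finset.sum_add_distrib, key, mul_assoc,
        ← Finset.mul_sum, ← ih]
      simp only [pathWeight_succ_zero]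
      ring
    · simp only [pathQuotient, add_mul _ _ (y _), Finset.sum_add_distrib, key, mul_assoc,
        ← Finset.mul_sum, ← ih]
      simp only [pathWeight_succ_succ]
      ring

lemma continuous_pathQuotient (j i h : ℕ) : Continuous fun y => pathQuotient j y i h := by
  induction i generalizing h with
  | zero => exact continuous_const
  | succ i ih =>
    rcases h with _ | h
    · have := ih 1
      simp only [pathQuotient]
      fun_prop
    · have := ih h
      have := ih (h + 2)
      simp only [pathQuotient]
      fun_prop

/-- Both branches solve the free walk recursion and agree at `h = j`; the first one vanishes at `h =
-1`. At `h = j + 1` they differ by `walkCount i (j + 1) - walkCount i (j + 3)`, which is the source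
term that enters at height `j`. -/
lemma pathQuotient_zero (j i h : ℕ) :
    pathQuotient j 0 i h =
      walkCount i (if h ≤ j then 2 * (j + 1) - h else h + 2) - walkCount i (2 * (j + 1) + h + 2) := by
  induction i generalizing h with
  | zero =>
    simp only [pathQuotient, walkCount]
    rw [if_neg (by split_ifs <;> omega), if_neg (by omega), sub_zero]
  | succ i ih =>
    rcases h with _ | h
    · simp only [pathQuotient, ih, pathWeight_one, walkCount_succ]
      rcases j with _ | j
      · norm_num
        ring
      · norm_num
        ring_nf
    · simp only [pathQuotient, ih, pathWeight_one, walkCount_succ, Pi.zero_apply, add_zero, one_mul]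
      push_cast
      rcases lt_trichotomy j (h + 1) with hj | hj | hj
      · by_cases hj' : h ≤ j
        · obtain rfl : j = h := by omega
          simp only [hj.ne, show ¬ j + 2 ≤ j by omega, show ¬ j + 1 ≤ j by omega, le_refl, if_true,
            if_false]
          ring_nf
        · simp only [hj.ne, hj', show ¬ h + 2 ≤ j by omega, show ¬ h + 1 ≤ j by omega, if_false]
          ring_nf
      · subst hj
        simp only [show ¬ h + 2 ≤ h + 1 by omega, show h ≤ h + 1 by omega, le_refl, if_true,
          if_false]
        push_cast
        ring_nf
      · simp only [hj.ne', show h + 2 ≤ j by omega, show h ≤ j by omega,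
          show h + 1 ≤ j by omega, if_true, if_false]
        ring_nf

lemma pathQuotient_zero_eq_matrixC (k : ℕ) (i j : Fin k) :
    pathQuotient j 0 (2 * (i + 1)) 0 = matrixC k i j := by
  rw [pathQuotient_zero, if_pos (Nat.zero_le _), matrixC]
  push_cast
  rw [sub_zero, add_zero]
  split_ifs with h1 h2
  · subst h1
    have := walkCount_sub_two_mul (2 * (j + 1)) 0
    push_cast at this
    rw [walkCount_eq_zero _ (2 * ((j : ℤ) + 1) + 2) (by push_cast; omega)]
    simpa using this
  · have h2' : (j : ℕ) < i := h2
    rw [← walkCount_sub_two_mul, ← walkCount_sub_two_mul]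
    congr 2 <;> push_cast [h2'.le, Nat.sub_sub, Nat.succ_le_of_lt h2'] <;> ring
  · have h2' : (i : ℕ) < j := by
      have : (i : ℕ) ≠ j := fun h => h1 (Fin.ext h.symm)
      have : ¬ (j : ℕ) < i := h2
      omega
    rw [walkCount_eq_zero _ _ (by push_cast; omega), walkCount_eq_zero _ _ (by push_cast; omega),
      sub_zero]

/-! ### Jacobi matrices: a measure attaining the lower bound. -/

lemma Matrix.IsHermitian.exists_spectral_weights {ι : Type*} [Fintype ι] [DecidableEq ι]
    {A : Matrix ι ι ℝ} (hA : A.IsHermitian) (a : ι) :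
    ∃ (w x : ι → ℝ), (∀ j, 0 ≤ w j) ∧ ∀ i : ℕ, (A ^ i) a a = ∑ j, w j * x j ^ i := by
  refine ⟨fun j => (hA.eigenvectorUnitary : Matrix ι ι ℝ) a j ^ 2, hA.eigenvalues,
    fun j => sq_nonneg _, fun i => ?_⟩
  conv_lhs => rw [hA.spectral_theorem, ← map_pow, Unitary.conjStarAlgAut_apply,
    Matrix.diagonal_pow, Matrix.mul_apply]
  refine Finset.sum_congr rfl fun j _ => ?_
  rw [Matrix.mul_diagonal]
  simp only [Matrix.star_apply, star_trivial, Pi.pow_apply, Function.comp_apply,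
    RCLike.ofReal_real_eq_id, id]
  ring

/-- The Jacobi matrix with zero diagonal and off-diagonal entries `√(z j)`. -/
noncomputable def jacobiMatrix (z : ℕ → ℝ) (k : ℕ) : Matrix (Fin (k + 1)) (Fin (k + 1)) ℝ :=
  fun a b => if (b : ℕ) = a + 1 then √(z a) else if (a : ℕ) = b + 1 then √(z b) else 0

lemma jacobiMatrix_isHermitian (z : ℕ → ℝ) (k : ℕ) : (jacobiMatrix z k).IsHermitian := by
  ext a b
  simp only [Matrix.conjTranspose_apply, jacobiMatrix, star_trivial]
  split_ifs <;> first | rfl | omega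

lemma jacobiMatrix_mulVec (z : ℕ → ℝ) (k : ℕ) (v : ℕ → ℝ) (hv : v (k + 1) = 0) (a : Fin (k + 1)) :
    (jacobiMatrix z k).mulVec (fun b => v b) a =
      √(z a) * v (a + 1) + if (a : ℕ) = 0 then 0 else √(z (a - 1)) * v (a - 1) := by
  have e (b : ℕ) : (if b = (a : ℕ) + 1 then √(z a) else if (a : ℕ) = b + 1 then √(z b) else 0) * v b
      = (if b = (a : ℕ) + 1 then √(z a) * v b else 0) +
        if b = (a : ℕ) - 1 then (if (a : ℕ) = 0 then 0 else √(z b) * v b) else 0 := by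
    split_ifs <;> first | omega | simp
  simp only [Matrix.mulVec, dotProduct, jacobiMatrix]
  rw [Fin.sum_univ_eq_sum_range (fun b =>
    (if b = (a : ℕ) + 1 then √(z a) else if (a : ℕ) = b + 1 then √(z b) else 0) * v b)]
  simp only [e, Finset.sum_add_distrib, Finset.sum_ite_eq', Finset.mem_range]
  rw [if_pos (by omega : (a : ℕ) - 1 < k + 1)]
  split_ifs with h1 h2 h2
  · rfl
  · rfl
  · rw [show (a : ℕ) + 1 = k + 1 by omega, hv, mul_zero]
  · rw [show (a : ℕ) + 1 = k + 1 by omega, hv, mul_zero]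

/-- Conjugating the path transfer operator by the diagonal `√(∏ z)` makes it symmetric. Since `z k =
0`, cutting it off at size `k + 1` loses nothing. -/
lemma jacobiMatrix_pow_mulVec {z : ℕ → ℝ} {k : ℕ} (hz : ∀ j, 0 ≤ z j) (hzk : ∀ j, k ≤ j → z j = 0)
    (i : ℕ) :
    ((jacobiMatrix z k) ^ i).mulVec (Pi.single 0 1) =
      fun a : Fin (k + 1) => √(∏ j ∈ Finset.range a, z j) * pathWeight z i a := by
  induction i with
  | zero =>
    ext a
    rw [pow_zero, Matrix.one_mulVec]
    rcases a with ⟨_ | a, ha⟩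
    · simp [pathWeight]
    · simp [pathWeight, Fin.ext_iff]
  | succ i ih =>
    rw [pow_succ', ← Matrix.mulVec_mulVec, ih]
    ext a
    rw [jacobiMatrix_mulVec z k (fun a => √(∏ j ∈ Finset.range a, z j) * pathWeight z i a)
      (by simp [Finset.prod_range_succ, hzk])]
    have hs (g : ℕ) : √(z g) * √(∏ j ∈ Finset.range (g + 1), z j) =
        √(∏ j ∈ Finset.range g, z j) * z g := by
      rw [Finset.prod_range_succ, Real.sqrt_mul (Finset.prod_nonneg fun j _ => hz j), mul_left_comm,
        Real.mul_self_sqrt (hz g)]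
    rcases a with ⟨_ | a, ha⟩
    · have := hs 0
      simp only [zero_add, Finset.range_zero, Finset.prod_empty] at this ⊢
      simp only [← mul_assoc, this, if_true, add_zero, pathWeight_succ_zero]
    · rw [if_neg (by simp)]
      simp only [Nat.add_sub_cancel, pathWeight_succ_succ, ← mul_assoc, hs]
      rw [Finset.prod_range_succ, Real.sqrt_mul (Finset.prod_nonneg fun j _ => hz j)]
      ring

lemma exists_hasMoments_stieltjesMoment {z : ℕ → ℝ} {k : ℕ} (hz : ∀ j, 0 ≤ z j)
    (hzk : ∀ j, k ≤ j → z j = 0) :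
    ∃ μ : Measure ℝ, ∀ n, HasMoments μ n (stieltjesMoment z) := by
  obtain ⟨w, x, hw, hwx⟩ := (jacobiMatrix_isHermitian z k).exists_spectral_weights 0
  -- Squaring the eigenvalues puts the atoms in `[0, ∞)` and selects the even powers of the Jacobi
  -- matrix, that is, the Dyck paths.
  have hmom (i : ℕ) : ∑ j, w j * (x j ^ 2) ^ i = stieltjesMoment z i := by
    have := congrFun (jacobiMatrix_pow_mulVec hz hzk (2 * i)) 0
    simp only [Matrix.mulVec_single_one, Matrix.col_apply, hwx] at this
    simp only [← pow_mul, this]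
    simp [stieltjesMoment]
  have hint (i : ℕ) (j : Fin (k + 1)) :
      Integrable (fun y : ℝ => y ^ i) (ENNReal.ofReal (w j) • Measure.dirac (x j ^ 2)) :=
    (integrable_dirac (by simp)).smul_measure ENNReal.ofReal_ne_top
  refine ⟨∑ j, ENNReal.ofReal (w j) • Measure.dirac (x j ^ 2), fun n => ⟨⟨?_⟩, ?_, fun i _ => ⟨?_, ?_⟩⟩⟩
  · have h0 := hmom 0
    simp only [pow_zero, mul_one, stieltjesMoment_zero] at h0
    simp only [Measure.coe_finsetSum, Finset.sum_apply, Measure.smul_apply, measure_univ,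
      smul_eq_mul, mul_one]
    rw [← ENNReal.ofReal_sum_of_nonneg fun j _ => hw j, h0, ENNReal.ofReal_one]
  · simp only [Measure.coe_finsetSum, Finset.sum_apply, Measure.smul_apply]
    refine Finset.sum_eq_zero fun j _ => ?_
    rw [Measure.dirac_apply' _ measurableSet_Iio, Set.indicator_of_notMem (by simp [sq_nonneg]),
      smul_zero]
  · exact integrable_finsetSum_measure.2 fun j _ => hint i j
  · rw [integral_finsetSum_measure fun j _ => hint i j, ← hmom i]
    refine Finset.sum_congr rfl fun j _ => ?_
    rw [integral_smul_measure, integral_dirac, ENNReal.toReal_ofReal (hw j), smul_eq_mul]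

/-! ### Orthogonal polynomials: the lower bound. -/

open Polynomial in
/-- The monic orthogonal polynomials of the symmetric distribution with Jacobi coefficients `z`. -/
noncomputable def symmOrthoPoly (z : ℕ → ℝ) : ℕ → ℝ[X]
  | 0 => 1
  | 1 => X
  | k + 2 => X * symmOrthoPoly z (k + 1) - C (z k) * symmOrthoPoly z k

open Polynomial in
lemma symmOrthoPoly_monic_natDegree (z : ℕ → ℝ) (k : ℕ) :
    (symmOrthoPoly z k).Monic ∧ (symmOrthoPoly z k).natDegree = k := by
  induction k using Nat.twoStepInduction with
  | zero => simp [symmOrthoPoly, monic_one]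
  | one => simp [symmOrthoPoly, monic_X]
  | more k ih0 ih1 =>
    have hm : (X * symmOrthoPoly z (k + 1)).Monic := monic_X.mul ih1.1
    have hd : (X * symmOrthoPoly z (k + 1)).natDegree = k + 2 := by
      rw [monic_X.natDegree_mul ih1.1, natDegree_X, ih1.2]; ring
    have hlt : (C (z k) * symmOrthoPoly z k).natDegree < (X * symmOrthoPoly z (k + 1)).natDegree := by
      refine (natDegree_C_mul_le _ _).trans_lt ?_
      rw [hd, ih0.2]
      omega
    rw [symmOrthoPoly]
    exact ⟨hm.sub_of_left (degree_lt_degree hlt), by rw [natDegree_sub_eq_left_of_natDegree_lt hlt, hd]⟩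

/-- One step of the weighted nonnegative path with steps `±1`. -/
def pathStep (z : ℕ → ℝ) : Module.End ℝ (ℕ → ℝ) where
  toFun v h := (if h = 0 then 0 else v (h - 1)) + z h * v (h + 1)
  map_add' v w := by ext h; simp only [Pi.add_apply]; split_ifs <;> ring
  map_smul' c v := by ext h; simp only [Pi.smul_apply, smul_eq_mul, RingHom.id_apply]; split_ifs <;> ring

lemma pathStep_apply (z : ℕ → ℝ) (v : ℕ → ℝ) (h : ℕ) :
    pathStep z v h = (if h = 0 then 0 else v (h - 1)) + z h * v (h + 1) := rfl

lemma pathStep_pow_single (z : ℕ → ℝ) (i : ℕ) :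
    (pathStep z ^ i) (Pi.single 0 1) = pathWeight z i := by
  induction i with
  | zero => ext h; simp [pathWeight, Pi.single_apply]
  | succ i ih =>
    ext h
    rw [pow_succ', Module.End.mul_apply, ih, pathStep_apply]
    rcases h with _ | h <;> simp [pathWeight]

/-- The three-term recurrence mirrors `T e_{j+1} = e_{j+2} + z_j e_j` for the step operator `T`. -/
lemma aeval_pathStep_symmOrthoPoly (z : ℕ → ℝ) (k : ℕ) :
    Polynomial.aeval (pathStep z) (symmOrthoPoly z k) (Pi.single 0 1) = Pi.single k 1 := by
  have e (j : ℕ) : pathStep z (Pi.single (j + 1) 1) = Pi.single (j + 2) 1 + z j • Pi.single j 1 := by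
    ext h
    simp only [pathStep_apply, Pi.add_apply, Pi.smul_apply, Pi.single_apply, smul_eq_mul]
    split_ifs <;> first | omega | simp_all
  induction k using Nat.twoStepInduction with
  | zero => simp [symmOrthoPoly]
  | one =>
    ext h
    simp only [symmOrthoPoly, Polynomial.aeval_X, pathStep_apply, Pi.single_apply]
    rw [if_neg (Nat.succ_ne_zero h), mul_zero, add_zero]
    split_ifs <;> first | omega | rfl
  | more k ih0 ih1 =>
    simp only [symmOrthoPoly, map_sub, map_mul, Polynomial.aeval_X, Polynomial.aeval_C,
      LinearMap.sub_apply, Module.End.mul_apply, ih0, ih1, e, Module.algebraMap_end_apply]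
    simp

lemma aeval_pathStep_apply_eq_zero {z : ℕ → ℝ} {k : ℕ} (hz : z k = 0) (p : Polynomial ℝ)
    (v : ℕ → ℝ) (hv : ∀ h ≤ k, v h = 0) :
    ∀ h ≤ k, Polynomial.aeval (pathStep z) p v h = 0 := by
  induction p using Polynomial.induction_on' with
  | add p q hp hq =>
    intro h hh
    simp [hp h hh, hq h hh]
  | monomial n a =>
    have hn : ∀ h ≤ k, (pathStep z ^ n) v h = 0 := by
      induction n with
      | zero => simpa using hv
      | succ n ih =>
        intro h hh
        rw [pow_succ', Module.End.mul_apply, pathStep_apply]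
        rcases hh.eq_or_lt with rfl | hlt
        · rw [hz, ih (h - 1) (by omega)]
          simp
        · rw [ih (h - 1) (by omega), ih (h + 1) (by omega)]
          simp
    intro h hh
    simp [Polynomial.aeval_monomial, hn h hh]

/-- The sum is the entry at height 0 of `P(T)² e_0 = P(T) e_{k+1}`, with `P` the polynomial of
degree `k + 1`. As `z k = 0`, no path descends from height `k + 1` to `k`. -/
lemma sum_coeff_symmOrthoPoly_sq {z : ℕ → ℝ} {k : ℕ} (hz : z k = 0) :
    ∑ i ∈ Finset.range (2 * (k + 1) + 1), (symmOrthoPoly z (k + 1) ^ 2).coeff i * pathWeight z i 0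
      = 0 := by
  have h1 := aeval_pathStep_apply_eq_zero hz (symmOrthoPoly z (k + 1)) (Pi.single (k + 1) 1)
    (fun h hh => by simp [Pi.single_apply]; omega) 0 (Nat.zero_le _)
  rw [← aeval_pathStep_symmOrthoPoly, ← Module.End.mul_apply, ← map_mul, ← sq,
    Polynomial.aeval_eq_sum_range' (n := 2 * (k + 1) + 1)] at h1
  · simpa [pathStep_pow_single] using h1
  · rw [(symmOrthoPoly_monic_natDegree z (k + 1)).1.natDegree_pow,
      (symmOrthoPoly_monic_natDegree z (k + 1)).2]
    omega

lemma stieltjesMoment_le_integral {z : ℕ → ℝ} {k : ℕ} (hz : z k = 0) {μ : Measure ℝ}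
    (hμ : HasMoments μ k (stieltjesMoment z)) (hint : Integrable (fun x : ℝ => x ^ (k + 1)) μ) :
    stieltjesMoment z (k + 1) ≤ ∫ x, x ^ (k + 1) ∂μ := by
  obtain ⟨hprob, hpos, hmom⟩ := hμ
  have hnn : ∀ᵐ x ∂μ, 0 ≤ x := by
    filter_upwards [measure_eq_zero_iff_ae_notMem.1 hpos] with x hx
    simpa using hx
  -- Averaging over `±√x` symmetrises the measure: odd powers cancel and even ones give the moments
  -- of `μ`. As `q` is monic and all moments up to `k` agree, `∫ q ≥ 0` is the claimed inequality.
  set q := symmOrthoPoly z (k + 1) ^ 2 with hq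
  have hqm : q.Monic := (symmOrthoPoly_monic_natDegree z (k + 1)).1.pow 2
  have hqd : q.natDegree = 2 * (k + 1) := by
    rw [hq, (symmOrthoPoly_monic_natDegree z (k + 1)).1.natDegree_pow,
      (symmOrthoPoly_monic_natDegree z (k + 1)).2]
  have hI (i : ℕ) (hi : i ≤ k + 1) : Integrable (fun x : ℝ => x ^ i) μ := by
    rcases Nat.eq_zero_or_pos i with rfl | h0
    · simp
    rcases hi.eq_or_lt with rfl | hlt
    · exact hint
    · exact (hmom i (Finset.mem_Icc.2 ⟨h0, by omega⟩)).1
  have hM (i : ℕ) (hi : i ≤ k) : ∫ x, x ^ i ∂μ = stieltjesMoment z i := by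
    rcases Nat.eq_zero_or_pos i with rfl | h0
    · simp [stieltjesMoment_zero]
    · exact (hmom i (Finset.mem_Icc.2 ⟨h0, hi⟩)).2
  have heven (j : ℕ) : (fun x : ℝ => (√x ^ (2 * j) + (-√x) ^ (2 * j)) / 2) =ᵐ[μ] fun x => x ^ j := by
    filter_upwards [hnn] with x hx
    simp only [pow_mul, neg_sq, Real.sq_sqrt hx]
    ring
  have hodd (j : ℕ) : (fun x : ℝ => (√x ^ (2 * j + 1) + (-√x) ^ (2 * j + 1)) / 2) = fun _ => 0 := by
    ext x
    rw [Odd.neg_pow ⟨j, rfl⟩]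
    ring
  have hSI (i : ℕ) (hi : i < 2 * (k + 1) + 1) :
      Integrable (fun x : ℝ => (√x ^ i + (-√x) ^ i) / 2) μ := by
    obtain ⟨j, rfl | rfl⟩ := Nat.even_or_odd' i
    · exact (hI j (by omega)).congr (heven j).symm
    · rw [hodd]; exact integrable_zero _ _ _
  have hS (i : ℕ) (hi : i < 2 * (k + 1)) :
      ∫ x, (√x ^ i + (-√x) ^ i) / 2 ∂μ = pathWeight z i 0 := by
    obtain ⟨j, rfl | rfl⟩ := Nat.even_or_odd' i
    · rw [integral_congr_ae (heven j), hM j (by omega), stieltjesMoment]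
    · rw [hodd, integral_zero, pathWeight_eq_zero_of_odd _ _ _ (by simp)]
  have key : ∫ x, (q.eval (√x) + q.eval (-√x)) / 2 ∂μ =
      ∑ i ∈ Finset.range (2 * (k + 1) + 1), q.coeff i * ∫ x, (√x ^ i + (-√x) ^ i) / 2 ∂μ := by
    simp only [← integral_const_mul]
    rw [← integral_finsetSum _ fun i hi => (hSI i (Finset.mem_range.1 hi)).const_mul _]
    congr 1 with x
    rw [Polynomial.eval_eq_sum_range, Polynomial.eval_eq_sum_range, hqd, ← Finset.sum_add_distrib,
      Finset.sum_div]
    exact Finset.sum_congr rfl fun i _ => by ring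
  have hge : 0 ≤ ∫ x, (q.eval (√x) + q.eval (-√x)) / 2 ∂μ := by
    refine integral_nonneg fun x => ?_
    simp only [hq, Polynomial.eval_pow, Pi.zero_apply]
    positivity
  have hzero := sum_coeff_symmOrthoPoly_sq hz
  have hlead : q.coeff (2 * (k + 1)) = 1 := by rw [← hqd]; exact hqm.coeff_natDegree
  rw [key, Finset.sum_range_succ, hlead, one_mul, integral_congr_ae (heven (k + 1)),
    Finset.sum_congr rfl fun i hi => by rw [hS i (Finset.mem_range.1 hi)]] at hge
  rw [← hq, Finset.sum_range_succ, hlead, one_mul] at hzero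
  rw [stieltjesMoment]
  linarith

/-! ### The coordinates `z_k` of a moment sequence. -/

lemma HasMoments.congr {μ : Measure ℝ} {k : ℕ} {c c' : ℕ → ℝ} (h : HasMoments μ k c)
    (hc : ∀ i ∈ Finset.Icc 1 k, c i = c' i) : HasMoments μ k c' :=
  ⟨h.1, h.2.1, fun i hi => ⟨(h.2.2 i hi).1, (h.2.2 i hi).2.trans (hc i hi)⟩⟩

lemma lowerMoment_succ_eq {z c : ℕ → ℝ} {k : ℕ} (hz : ∀ j < k, 0 ≤ z j)
    (hc : ∀ i ≤ k, c i = stieltjesMoment z i) :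
    lowerMoment c (k + 1) = stieltjesMoment (Function.update z k 0) (k + 1) := by
  -- Truncation leaves the moments up to `k` unchanged and supplies both the finite Jacobi matrix
  -- and the zero weight at `k`.
  set z' : ℕ → ℝ := fun j => if j < k then z j else 0 with hz'
  have h1 : stieltjesMoment (Function.update z k 0) (k + 1) = stieltjesMoment z' (k + 1) := by
    refine stieltjesMoment_congr _ fun j hj => ?_
    rcases (Nat.lt_succ_iff.1 hj).eq_or_lt with rfl | hlt
    · simp [z']
    · rw [Function.update_of_ne hlt.ne]
      simp [z', hlt]
  have h2 (i : ℕ) (hi : i ∈ Finset.Icc 1 k) : c i = stieltjesMoment z' i := by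
    rw [hc i (Finset.mem_Icc.1 hi).2]
    refine stieltjesMoment_congr _ fun j hj => ?_
    simp [z', show j < k from hj.trans_le (Finset.mem_Icc.1 hi).2]
  obtain ⟨μ, hμ⟩ := exists_hasMoments_stieltjesMoment (z := z') (k := k)
    (fun j => by simp only [z']; split_ifs with h; exacts [hz j h, le_rfl])
    (fun j hj => by simp [z', hj])
  rw [h1, lowerMoment]
  refine IsLeast.csInf_eq ⟨⟨μ, (hμ k).congr fun i hi => (h2 i hi).symm,
    (hμ (k + 1)).2.2 (k + 1) (by simp)⟩, ?_⟩
  rintro y ⟨ν, hν, hνi, rfl⟩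
  exact stieltjesMoment_le_integral (by simp [z']) (hν.congr h2) hνi

lemma sub_lowerMoment_eq_prod {z c : ℕ → ℝ} {k : ℕ} (hz : ∀ j < k, 0 ≤ z j)
    (hc : ∀ i ≤ k, c i = stieltjesMoment z i) :
    c k - lowerMoment c k = ∏ j ∈ Finset.range k, z j := by
  rcases k with _ | k
  · rw [hc 0 le_rfl, stieltjesMoment_zero]
    simp [lowerMoment]
  · rw [lowerMoment_succ_eq (fun j hj => hz j (by omega)) fun i hi => hc i (by omega), hc _ le_rfl,
      stieltjesMoment_succ_eq]
    ring

lemma recursionVar_succ_eq {z c : ℕ → ℝ} {k : ℕ} (hz : ∀ j ≤ k, 0 < z j)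
    (hc : ∀ i ≤ k + 1, c i = stieltjesMoment z i) : recursionVar c (k + 1) = z k := by
  rw [recursionVar, Nat.add_sub_cancel,
    sub_lowerMoment_eq_prod (fun j hj => (hz j (by omega)).le) hc,
    sub_lowerMoment_eq_prod (fun j hj => (hz j (by omega)).le) fun i hi => hc i (by omega),
    Finset.prod_range_succ, mul_div_cancel_left₀]
  exact (Finset.prod_pos fun j hj => hz j (Finset.mem_range.1 hj).le).ne'

/-- The strict inequalities suffice: once the first `n` moments are path counts with positive
weights, the next lower bound is known, and the excess over it determines the next weight. -/
lemma recursionVar_pos_and_eq_stieltjesMoment {c : ℕ → ℝ} {n : ℕ} (h0 : c 0 = 1)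
    (hc : ∀ k ∈ Finset.Icc 1 n, lowerMoment c k < c k) :
    (∀ j < n, 0 < recursionVar c (j + 1)) ∧
      ∀ i ≤ n, c i = stieltjesMoment (fun j => recursionVar c (j + 1)) i := by
  induction n with
  | zero =>
    refine ⟨by simp, fun i hi => ?_⟩
    obtain rfl : i = 0 := by omega
    rw [h0, stieltjesMoment_zero]
  | succ n ih =>
    obtain ⟨hpos, heq⟩ := ih fun k hk => hc k (by simp at hk ⊢; omega)
    set z : ℕ → ℝ := fun j => recursionVar c (j + 1) with hz
    have hn := hc (n + 1) (by simp)
    have hprod := sub_lowerMoment_eq_prod (z := z) (fun j hj => (hpos j hj).le) heq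
    have hP : 0 < ∏ j ∈ Finset.range n, z j :=
      Finset.prod_pos fun j hj => hpos j (Finset.mem_range.1 hj)
    have hzn : z n = (c (n + 1) - lowerMoment c (n + 1)) / ∏ j ∈ Finset.range n, z j := by
      rw [← hprod]; rfl
    have hzn' : 0 < z n := by
      rw [hzn]
      exact div_pos (by linarith) hP
    refine ⟨fun j hj => ?_, fun i hi => ?_⟩
    · rcases (Nat.lt_succ_iff.1 hj).eq_or_lt with rfl | hlt
      exacts [hzn', hpos j hlt]
    · rcases hi.eq_or_lt with rfl | hlt
      · rw [stieltjesMoment_succ_eq, ← lowerMoment_succ_eq (fun j hj => (hpos j hj).le) heq,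
          Finset.prod_range_succ, hzn, mul_div_cancel₀ _ hP.ne']
        ring
      · exact heq i (by omega)

/-! ### The coordinate map and its Jacobian. -/

/-- A vector with coordinates `0, …, n - 1`, continued by zeros. -/
def zeroExtend {n : ℕ} (z : Fin n → ℝ) (j : ℕ) : ℝ := if h : j < n then z ⟨j, h⟩ else 0

lemma zeroExtend_val {n : ℕ} (z : Fin n → ℝ) (i : Fin n) : zeroExtend z i = z i := by
  simp [zeroExtend]

/-- The map from the canonical coordinates to the moment vectors. -/
def stieltjesMap (n : ℕ) (z : Fin n → ℝ) : Fin n → ℝ :=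
  fun i => stieltjesMoment (zeroExtend z) (i + 1)

lemma momentSeq_stieltjesMap {n : ℕ} (z : Fin n → ℝ) (i : ℕ) (hi : i ≤ n) :
    momentSeq (stieltjesMap n z) i = stieltjesMoment (zeroExtend z) i := by
  rcases i with _ | i
  · rw [stieltjesMoment_zero, momentSeq]
  · simp [momentSeq, stieltjesMap, Nat.lt_of_succ_le hi]

lemma zeroExtend_pos {n : ℕ} {z : Fin n → ℝ} (hz : ∀ i, 0 < z i)
    {j : ℕ} (hj : j < n) : 0 < zeroExtend z j := by
  simp [zeroExtend, hj, hz]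

lemma zeroExtend_nonneg {n : ℕ} {z : Fin n → ℝ} (hz : ∀ i, 0 < z i)
    (j : ℕ) : 0 ≤ zeroExtend z j := by
  by_cases hj : j < n
  · exact (zeroExtend_pos hz hj).le
  · simp [zeroExtend, hj]

lemma recursionVar_stieltjesMap {n : ℕ} {z : Fin n → ℝ} (hz : ∀ i, 0 < z i)
    (i : Fin n) :
    recursionVar (momentSeq (stieltjesMap n z)) (i + 1) = z i := by
  rw [recursionVar_succ_eq (z := zeroExtend z) (fun j hj => zeroExtend_pos hz (by omega))
    fun j hj => momentSeq_stieltjesMap z j (by omega), zeroExtend_val]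

lemma lowerMoment_stieltjesMap_lt {n : ℕ} {z : Fin n → ℝ} (hz : ∀ i, 0 < z i)
    {k : ℕ} (hk : k ∈ Finset.Icc 1 n) :
    lowerMoment (momentSeq (stieltjesMap n z)) k < momentSeq (stieltjesMap n z) k := by
  rw [Finset.mem_Icc] at hk
  rw [← sub_pos, sub_lowerMoment_eq_prod (z := zeroExtend z) (fun j _ => zeroExtend_nonneg hz j)
    fun j hj => momentSeq_stieltjesMap z j (by omega)]
  refine Finset.prod_pos fun j hj => zeroExtend_pos hz ?_
  rw [Finset.mem_range] at hj
  omega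

lemma stieltjesMap_mem_momentSpace {n : ℕ} {z : Fin n → ℝ} (hz : ∀ i, 0 < z i) :
    stieltjesMap n z ∈ momentSpace n := by
  obtain ⟨μ, hμ⟩ := exists_hasMoments_stieltjesMoment (z := zeroExtend z) (k := n)
    (zeroExtend_nonneg hz) (fun j hj => by simp [zeroExtend, hj])
  exact ⟨μ, (hμ n).congr fun i hi =>
    (momentSeq_stieltjesMap z i (Finset.mem_Icc.1 hi).2).symm⟩

/-- The Jacobian factor adds `n - k` to the exponent of `z_k`, which is the exponent of a gamma
density of shape `γ_k + n - k + 1`; the constants already match. -/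
lemma momentDensity_stieltjesMap_mul {n : ℕ} {z : Fin n → ℝ} (hz : ∀ i, 0 < z i)
    (γ δ : ℕ → ℝ) :
    momentDensity n γ δ (stieltjesMap n z) * ∏ i : Fin n, z i ^ (n - 1 - i : ℕ) =
      ∏ i : Fin n, gammaPDFReal (γ (i + 1) + n - (i + 1 : ℕ) + 1) (δ (i + 1)) (z i) := by
  have e (f : ℕ → ℝ) : ∏ k ∈ Finset.Icc 1 n, f k = ∏ i : Fin n, f (i + 1) := by
    rw [Fin.prod_univ_eq_prod_range (fun i => f (i + 1)), ← Finset.Ico_succ_right_eq_Icc,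
      Finset.prod_Ico_eq_prod_range]
    simp [add_comm]
  rw [momentDensity, if_pos ⟨stieltjesMap_mem_momentSpace hz,
    fun k hk => lowerMoment_stieltjesMap_lt hz hk⟩, e, e, ← Finset.prod_mul_distrib,
    ← Finset.prod_mul_distrib]
  refine Finset.prod_congr rfl fun i _ => ?_
  rw [recursionVar_stieltjesMap hz, gammaPDFReal, if_pos (hz i).le,
    show γ (i + 1) + (n : ℝ) - ((i + 1 : ℕ) : ℝ) + 1 - 1 = γ (i + 1) + (n - 1 - i : ℕ) by
      rw [Nat.sub_sub, Nat.cast_sub (by omega)]; push_cast; ring,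
    Real.rpow_add (hz i), Real.rpow_natCast, neg_mul]
  ring

lemma exists_stieltjesMap_eq_of_momentDensity_ne_zero {n : ℕ} {γ δ : ℕ → ℝ} {m : Fin n → ℝ}
    (hm : momentDensity n γ δ m ≠ 0) : ∃ z : Fin n → ℝ, (∀ i, 0 < z i) ∧ stieltjesMap n z = m := by
  have hc : ∀ k ∈ Finset.Icc 1 n, lowerMoment (momentSeq m) k < momentSeq m k := by
    by_contra h
    exact hm (if_neg fun h' => h h'.2)
  obtain ⟨hpos, heq⟩ := recursionVar_pos_and_eq_stieltjesMoment (c := momentSeq m) rfl hc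
  refine ⟨fun i => recursionVar (momentSeq m) (i + 1), fun i => hpos i i.2, funext fun i => ?_⟩
  have h1 := heq (i + 1) i.2
  rw [momentSeq, dif_pos i.2] at h1
  rw [stieltjesMap, h1]
  refine stieltjesMoment_congr _ fun j hj => ?_
  simp [zeroExtend, show j < n by omega]

lemma injOn_stieltjesMap (n : ℕ) : Set.InjOn (stieltjesMap n) {z | ∀ i, 0 < z i} := by
  intro z hz z' hz' h
  ext i
  rw [← recursionVar_stieltjesMap hz, h, recursionVar_stieltjesMap hz']

lemma differentiable_pathWeight_zeroExtend (n i h : ℕ) :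
    Differentiable ℝ fun z : Fin n → ℝ => pathWeight (zeroExtend z) i h := by
  have hz (j : ℕ) : Differentiable ℝ fun z : Fin n → ℝ => zeroExtend z j := by
    by_cases hj : j < n
    · simp only [zeroExtend, hj, dif_pos]
      fun_prop
    · simp only [zeroExtend, hj, dif_neg, not_false_eq_true]
      fun_prop
  induction i generalizing h with
  | zero => exact differentiable_const _
  | succ i ih =>
    rcases h with _ | h
    · exact (hz 0).mul (ih 1)
    · exact (ih h).add ((hz (h + 1)).mul (ih (h + 2)))

lemma differentiable_stieltjesMap (n : ℕ) : Differentiable ℝ (stieltjesMap n) :=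
  differentiable_pi.2 fun _ => differentiable_pathWeight_zeroExtend n _ _

lemma hasDerivAt_stieltjesMap_update {n : ℕ} (z : Fin n → ℝ) (i j : Fin n) :
    HasDerivAt (fun t => stieltjesMap n (Function.update z j t) i)
      (fderiv ℝ (stieltjesMap n) z (Pi.single j 1) i) (z j) := by
  have h := (differentiable_stieltjesMap n (Function.update z j (z j))).hasFDerivAt.comp_hasDerivAt
    (z j) (hasDerivAt_update z j (z j))
  rw [Function.update_eq_self] at h
  exact hasDerivAt_pi.1 h i

lemma zeroExtend_update {n : ℕ} (z : Fin n → ℝ) (j : Fin n) (t : ℝ) :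
    zeroExtend (Function.update z j t) = Function.update (zeroExtend z) j t := by
  ext k
  by_cases hk : k < n
  · simp [zeroExtend, hk, Function.update_apply, Fin.ext_iff]
  · rw [Function.update_of_ne (by omega)]
    simp [zeroExtend, hk]

lemma fderiv_stieltjesMap_of_lt {n : ℕ} (z : Fin n → ℝ) {i j : Fin n} (hij : i < j) :
    fderiv ℝ (stieltjesMap n) z (Pi.single j 1) i = 0 := by
  refine (hasDerivAt_stieltjesMap_update z i j).unique ?_
  convert hasDerivAt_const (z j) (stieltjesMap n z i) using 2 with t
  refine stieltjesMoment_congr _ fun k hk => ?_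
  have : (i : ℕ) < j := hij
  rw [zeroExtend_update, Function.update_of_ne (by omega)]

lemma fderiv_stieltjesMap_self {n : ℕ} (z : Fin n → ℝ) (i : Fin n) :
    fderiv ℝ (stieltjesMap n) z (Pi.single i 1) i = ∏ j ∈ Finset.range i, zeroExtend z j := by
  refine (hasDerivAt_stieltjesMap_update z i i).unique ?_
  have h := ((hasDerivAt_id (z i)).const_mul (∏ j ∈ Finset.range i, zeroExtend z j)).const_add
    (stieltjesMoment (Function.update (zeroExtend z) i 0) (i + 1))
  rw [mul_one] at h
  convert h using 2 with t
  rw [stieltjesMap, zeroExtend_update, stieltjesMoment_succ_eq, Function.update_idem,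
    Finset.prod_range_succ, Function.update_self]
  congr 2
  refine Finset.prod_congr rfl fun j hj => ?_
  rw [Function.update_of_ne (Finset.mem_range.1 hj).ne]

/-- The factor `e j` occurs once for each `i` with `j < i < n`. -/
lemma prod_range_prod_range (e : ℕ → ℝ) (n : ℕ) :
    ∏ i ∈ Finset.range n, ∏ j ∈ Finset.range i, e j =
      ∏ j ∈ Finset.range n, e j ^ (n - 1 - j) := by
  induction n with
  | zero => simp
  | succ n ih =>
    rw [Finset.prod_range_succ, ih, Finset.prod_range_succ, ← Finset.prod_mul_distrib]
    simp only [Nat.add_sub_cancel, Nat.sub_self, pow_zero, mul_one]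
    refine Finset.prod_congr rfl fun j hj => ?_
    rw [← pow_succ, show n - 1 - j + 1 = n - j by have := Finset.mem_range.1 hj; omega]

lemma det_fderiv_stieltjesMap {n : ℕ} (z : Fin n → ℝ) :
    (fderiv ℝ (stieltjesMap n) z).det = ∏ i : Fin n, z i ^ (n - 1 - i : ℕ) := by
  rw [ContinuousLinearMap.det, ← LinearMap.det_toMatrix', Matrix.det_of_isLowerTriangular]
  · simp only [LinearMap.toMatrix'_apply, ContinuousLinearMap.coe_coe, fderiv_stieltjesMap_self,
      ← zeroExtend_val z]
    rw [Fin.prod_univ_eq_prod_range (fun i => ∏ j ∈ Finset.range i, zeroExtend z j),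
      Fin.prod_univ_eq_prod_range (fun i => zeroExtend z i ^ (n - 1 - i)), prod_range_prod_range]
  · intro i j hij
    rw [LinearMap.toMatrix'_apply]
    exact fderiv_stieltjesMap_of_lt z hij

/-! ### Change of variables to independent gamma laws. -/

lemma lintegral_fin_prod_eq_prod {n : ℕ} {E : Fin n → Type*} {mE : ∀ i, MeasurableSpace (E i)}
    {μ : (i : Fin n) → Measure (E i)} [∀ i, SigmaFinite (μ i)]
    {f : (i : Fin n) → E i → ENNReal} (hf : ∀ i, Measurable (f i)) :
    ∫⁻ x : (i : Fin n) → E i, ∏ i, f i (x i) ∂(Measure.pi μ) = ∏ i, ∫⁻ x, f i x ∂(μ i) := by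
  induction n with
  | zero => simp
  | succ n ih =>
    rw [← ((measurePreserving_piFinSuccAbove μ 0).symm).lintegral_comp_emb
        (MeasurableEquiv.measurableEmbedding _)]
    rw [Fin.prod_univ_succ, ← ih fun i => hf i.succ]
    refine (lintegral_congr fun x => ?_).trans (lintegral_prod_mul (hf 0).aemeasurable
      (Finset.measurable_fun_prod _ fun i _ =>
        (hf i.succ).comp (measurable_pi_apply i)).aemeasurable)
    rw [Fin.prod_univ_succ]
    rfl

lemma pi_withDensity {n : ℕ} {E : Fin n → Type*} {mE : ∀ i, MeasurableSpace (E i)}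
    {μ : (i : Fin n) → Measure (E i)} [∀ i, SigmaFinite (μ i)]
    {f : (i : Fin n) → E i → ENNReal} (hf : ∀ i, Measurable (f i))
    [∀ i, SigmaFinite ((μ i).withDensity (f i))] :
    Measure.pi (fun i => (μ i).withDensity (f i)) =
      (Measure.pi μ).withDensity fun x => ∏ i, f i (x i) := by
  refine Measure.pi_eq fun s hs => ?_
  rw [withDensity_apply _ (MeasurableSet.univ_pi hs), Measure.restrict_pi_pi,
    lintegral_fin_prod_eq_prod hf]
  exact Finset.prod_congr rfl fun i _ => (withDensity_apply _ (hs i)).symm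

lemma measurable_gammaPDF (a r : ℝ) : Measurable (gammaPDF a r) :=
  (measurable_gammaPDFReal a r).ennreal_ofReal

/-- `gammaPDF` is supported on `[0, ∞)`; discarding the null point `0` leaves the open orthant,
where the coordinate map is injective. -/
lemma gammaMeasure_eq_restrict_Ioi (a r : ℝ) :
    gammaMeasure a r = (volume.restrict (Set.Ioi 0)).withDensity (gammaPDF a r) := by
  rw [← restrict_withDensity measurableSet_Ioi, ← gammaMeasure, Measure.restrict_eq_self_of_ae_mem]
  rw [gammaMeasure, ae_withDensity_iff (measurable_gammaPDF a r)]
  filter_upwards [Measure.ae_ne volume (0 : ℝ)] with x hx hx'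
  by_contra h
  exact hx' (gammaPDF_of_neg (lt_of_le_of_ne (not_lt.1 h) hx))

lemma momentLaw_eq_map_pi_gammaMeasure {n : ℕ} {γ δ : ℕ → ℝ}
    (hγ : ∀ i : Fin n, 0 < γ (i + 1) + n - (i + 1 : ℕ) + 1) (hδ : ∀ i : Fin n, 0 < δ (i + 1)) :
    momentLaw n γ δ = (Measure.pi fun i : Fin n =>
      gammaMeasure (γ (i + 1) + n - (i + 1 : ℕ) + 1) (δ (i + 1))).map (stieltjesMap n) := by
  set S : Set (Fin n → ℝ) := {z | ∀ i, 0 < z i} with hS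
  have hSpi : S = Set.univ.pi fun _ => Set.Ioi 0 := by ext; simp [S]
  have hSm : MeasurableSet S := by
    rw [hSpi]; exact MeasurableSet.univ_pi fun _ => measurableSet_Ioi
  have hder : ∀ z ∈ S, HasFDerivWithinAt (stieltjesMap n) (fderiv ℝ (stieltjesMap n) z) S z :=
    fun z _ => (differentiable_stieltjesMap n z).hasFDerivAt.hasFDerivWithinAt
  have hmeas : Measurable (stieltjesMap n) := (differentiable_stieltjesMap n).continuous.measurable
  have hprob (i : Fin n) := isProbabilityMeasure_gammaMeasure (hγ i) (hδ i)
  simp only [gammaMeasure_eq_restrict_Ioi] at hprob ⊢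
  rw [pi_withDensity fun i => measurable_gammaPDF _ _, ← Measure.restrict_pi_pi, ← hSpi,
    ← volume_pi]
  ext B hB
  rw [momentLaw, withDensity_apply _ hB, Measure.map_apply hmeas hB,
    withDensity_apply _ (hmeas hB), ← lintegral_indicator hB, ← lintegral_indicator (hmeas hB)]
  -- The density vanishes off the image of the orthant, so only the image contributes to the
  -- integral.
  have h0 : B.indicator (fun m => ENNReal.ofReal (momentDensity n γ δ m)) =
      (stieltjesMap n '' S).indicator
        (B.indicator fun m => ENNReal.ofReal (momentDensity n γ δ m)) := by
    refine (Set.indicator_eq_self.2 fun m hm => ?_).symm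
    by_contra h
    have : momentDensity n γ δ m = 0 := by
      by_contra hne
      obtain ⟨z, hz, rfl⟩ := exists_stieltjesMap_eq_of_momentDensity_ne_zero hne
      exact h ⟨z, hz, rfl⟩
    simp [this] at hm
  rw [h0, lintegral_indicator (measurable_image_of_fderivWithin hSm hder (injOn_stieltjesMap n)),
    lintegral_image_eq_lintegral_abs_det_fderiv_mul volume hSm hder (injOn_stieltjesMap n)]
  refine setLIntegral_congr_fun hSm fun z hz => ?_
  have hz' : ∀ i, 0 < z i := hz
  simp only [det_fderiv_stieltjesMap]
  by_cases hzB : stieltjesMap n z ∈ B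
  · rw [Set.indicator_of_mem hzB, Set.indicator_of_mem (show z ∈ stieltjesMap n ⁻¹' B from hzB)]
    simp only [gammaPDF]
    rw [← ENNReal.ofReal_prod_of_nonneg fun i _ => gammaPDFReal_nonneg (hγ i) (hδ i) _,
      ← momentDensity_stieltjesMap_mul hz' γ δ,
      abs_of_nonneg (Finset.prod_nonneg fun i _ => pow_nonneg (hz' i).le _), mul_comm,
      ENNReal.ofReal_mul' (Finset.prod_nonneg fun i _ => pow_nonneg (hz' i).le _)]
  · rw [Set.indicator_of_notMem hzB, mul_zero,
      Set.indicator_of_notMem (show z ∉ stieltjesMap n ⁻¹' B from hzB)]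

/-! ### Normal limit of gamma variables. -/

lemma mgf_gammaMeasure {a r : ℝ} (ha : 0 < a) (hr : 0 < r) {t : ℝ} (ht : t < r) :
    mgf id (gammaMeasure a r) t = (r / (r - t)) ^ a := by
  rw [mgf, gammaMeasure_eq_restrict_Ioi,
    integral_withDensity_eq_integral_toReal_smul (measurable_gammaPDF a r)
      (ae_of_all _ fun x => ENNReal.ofReal_lt_top)]
  have h : ∀ x ∈ Set.Ioi (0 : ℝ), (gammaPDF a r x).toReal • Real.exp (t * id x) =
      r ^ a / Real.Gamma a * (x ^ (a - 1) * Real.exp (-((r - t) * x))) := by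
    intro x hx
    rw [gammaPDF, ENNReal.toReal_ofReal (gammaPDFReal_nonneg ha hr x), gammaPDFReal,
      if_pos (le_of_lt hx), smul_eq_mul, mul_assoc, ← Real.exp_add, ← mul_assoc]
    congr 2
    simp only [id]
    ring
  rw [setIntegral_congr_fun measurableSet_Ioi h, integral_const_mul,
    Real.integral_rpow_mul_exp_neg_mul_Ioi ha (sub_pos.2 ht), Real.div_rpow hr.le (sub_pos.2 ht).le,
    Real.div_rpow zero_le_one (sub_pos.2 ht).le, Real.one_rpow]
  have := (Real.Gamma_pos_of_pos ha).ne'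
  field_simp

lemma Iio_subset_integrableExpSet_gammaMeasure {a r : ℝ} (ha : 0 < a) (hr : 0 < r) :
    Set.Iio r ⊆ integrableExpSet id (gammaMeasure a r) := by
  intro t ht
  rw [integrableExpSet, Set.mem_ofPred_eq]
  -- A non-integrable function has integral `0` by convention, whereas the formula for the mgf is
  -- positive.
  refine not_imp_comm.1 integral_undef ?_
  have := mgf_gammaMeasure ha hr ht
  rw [mgf] at this
  rw [this]
  exact (Real.rpow_pos_of_pos (div_pos hr (sub_pos.2 ht)) a).ne'

/-- Identity theorem on the half-plane `re z < r`: both sides are analytic and agree at the points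
`-1/(n+1)`, which accumulate at `0`. -/
lemma complexMGF_gammaMeasure {a r : ℝ} (ha : 0 < a) (hr : 0 < r) {z : ℂ} (hz : z.re < r) :
    complexMGF id (gammaMeasure a r) z = Complex.exp (-(a * Complex.log (1 - z / r))) := by
  have hopen : IsOpen {z : ℂ | z.re < r} := isOpen_lt Complex.continuous_re continuous_const
  have hpre : IsPreconnected {z : ℂ | z.re < r} := (convex_halfSpace_re_lt r).isPreconnected
  have hf : AnalyticOnNhd ℂ (complexMGF id (gammaMeasure a r)) {z : ℂ | z.re < r} := by
    refine analyticOnNhd_complexMGF.mono fun z hz => ?_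
    exact interior_mono (Iio_subset_integrableExpSet_gammaMeasure ha hr)
      (by rw [interior_Iio]; exact hz)
  have hg : AnalyticOnNhd ℂ (fun z : ℂ => Complex.exp (-(a * Complex.log (1 - z / r))))
      {z : ℂ | z.re < r} := by
    refine DifferentiableOn.analyticOnNhd (fun z hz => ?_) hopen
    have : (1 - z / r) ∈ Complex.slitPlane := by
      left
      have : z.re / r < 1 := (div_lt_one hr).2 hz
      simpa [Complex.div_ofReal_re] using this
    have hd : DifferentiableAt ℂ (fun z : ℂ => 1 - z / r) z := by fun_prop
    exact ((hd.clog this).const_mul _).neg.cexp.differentiableWithinAt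
  refine hf.eqOn_of_preconnected_of_frequently_eq hg hpre (z₀ := 0) (by simpa using hr) ?_ hz
  have hlim : Tendsto (fun n : ℕ => ((-(1 / ((n : ℝ) + 1)) : ℝ) : ℂ)) atTop (𝓝[≠] 0) := by
    refine tendsto_nhdsWithin_iff.2 ⟨?_, Eventually.of_forall fun n => ?_⟩
    · have := tendsto_one_div_add_atTop_nhds_zero_nat (𝕜 := ℝ)
      simpa [Function.comp_def] using (Complex.continuous_ofReal.tendsto _).comp this.neg
    · have : (-(1 / ((n : ℝ) + 1))) ≠ 0 := by
        have : (0 : ℝ) < 1 / ((n : ℝ) + 1) := by positivity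
        linarith
      exact Complex.ofReal_ne_zero.2 this
  refine hlim.frequently (Eventually.frequently (Eventually.of_forall fun n => ?_))
  set t : ℝ := -(1 / ((n : ℝ) + 1)) with ht
  have ht0 : t < 0 := by
    have : (0 : ℝ) < 1 / ((n : ℝ) + 1) := by positivity
    linarith
  have h1 : 0 < 1 - t / r := by
    have := div_neg_of_neg_of_pos ht0 hr
    linarith
  rw [complexMGF_ofReal, mgf_gammaMeasure ha hr (ht0.trans hr), Real.rpow_def_of_pos
    (div_pos hr (by linarith)), show r / (r - t) = (1 - t / r)⁻¹ by field_simp, Real.log_inv]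
  rw [← Complex.ofReal_div, ← Complex.ofReal_one, ← Complex.ofReal_sub,
    ← Complex.ofReal_log h1.le]
  push_cast
  congr 1
  ring

lemma charFun_map_sqrt_mul_sub_one (μ : Measure ℝ) (s t : ℝ) :
    charFun (μ.map fun x => s * (x - 1)) t =
      Complex.exp (-(t * s * Complex.I)) * complexMGF id μ (t * s * Complex.I) := by
  rw [charFun_apply_real, integral_map (by fun_prop) (by fun_prop), complexMGF,
    ← integral_const_mul]
  congr 1 with x
  rw [← Complex.exp_add]
  congr 1
  simp only [id]
  push_cast
  ring

/-- Put `u = -it/√n`. In `n log (1 + u)` the linear term cancels the centring, the quadratic one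
gives `-t²/2`, and the rest is `n O(u³) → 0`. The shift `c` only contributes `c log (1 + u) → 0`. -/
lemma tendsto_exponent_gamma (c t : ℝ) :
    Tendsto (fun n : ℕ => -(t * √(n : ℝ) * Complex.I) -
      ((n + c : ℝ) * Complex.log (1 - t * √(n : ℝ) * Complex.I / (n : ℝ)) : ℂ)) atTop
      (𝓝 (-(t ^ 2 / 2))) := by
  obtain ⟨u, hu⟩ : ∃ u : ℕ → ℂ, u = fun n : ℕ => -(t * √(n : ℝ) * Complex.I / (n : ℝ)) := ⟨_, rfl⟩
  have hs (n : ℕ) : ((√(n : ℝ) : ℝ) : ℂ) ^ 2 = n := by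
    rw [← Complex.ofReal_pow, Real.sq_sqrt (Nat.cast_nonneg n)]; simp
  have hu1 : ∀ᶠ n : ℕ in atTop, (n : ℂ) * u n = -(t * √(n : ℝ) * Complex.I) := by
    filter_upwards [eventually_ne_atTop 0] with n hn
    have : (n : ℂ) ≠ 0 := by exact_mod_cast hn
    simp only [hu, Complex.ofReal_natCast]
    field_simp
  have hu2 : ∀ᶠ n : ℕ in atTop, (n : ℂ) * u n ^ 2 = -t ^ 2 := by
    filter_upwards [eventually_ne_atTop 0] with n hn
    have : (n : ℂ) ≠ 0 := by exact_mod_cast hn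
    simp only [hu, Complex.ofReal_natCast, neg_sq, div_pow, mul_pow, hs, Complex.I_sq]
    field_simp
  have hu0 : Tendsto u atTop (𝓝 0) := by
    have h1 : Tendsto (fun n : ℕ => ((t * (√(n : ℝ))⁻¹ : ℝ) : ℂ)) atTop (𝓝 ((t * 0 : ℝ) : ℂ)) :=
      (Complex.continuous_ofReal.tendsto _).comp (tendsto_const_nhds.mul
        (tendsto_inv_atTop_zero.comp (Real.tendsto_sqrt_atTop.comp tendsto_natCast_atTop_atTop)))
    have h2 := (h1.mul_const Complex.I).neg
    simp only [mul_zero, Complex.ofReal_zero, zero_mul, neg_zero] at h2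
    refine h2.congr fun n => ?_
    simp only [hu, ← Real.sqrt_div_self]
    push_cast
    ring
  have hlog : Tendsto (fun n => Complex.log (1 + u n)) atTop (𝓝 0) := by
    have : ContinuousAt (fun w : ℂ => Complex.log (1 + w)) 0 :=
      (continuousAt_const.add continuousAt_id).clog (by simp)
    have h := this.tendsto.comp hu0
    simpa [Function.comp_def] using h
  have hO : Tendsto (fun n : ℕ => (n : ℂ) * (Complex.log (1 + u n) - Complex.logTaylor 3 (u n)))
      atTop (𝓝 0) := by
    have h1 := (Asymptotics.isBigO_refl (fun n : ℕ => (n : ℂ)) atTop).mul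
      ((Complex.log_sub_logTaylor_isBigO 2).comp_tendsto hu0)
    refine h1.trans_tendsto ?_
    have h2 : Tendsto (fun n => -(t : ℂ) ^ 2 * u n) atTop (𝓝 0) := by
      simpa using hu0.const_mul (-(t : ℂ) ^ 2)
    refine h2.congr' ?_
    filter_upwards [hu2] with n hn
    simp only [Function.comp_apply]
    rw [← hn]
    ring
  have hmain := (hO.neg.add_const (-((t : ℂ) ^ 2 / 2))).sub (hlog.const_mul (c : ℂ))
  simp only [neg_zero, zero_add, mul_zero, sub_zero] at hmain
  refine hmain.congr' ?_
  filter_upwards [hu1, hu2] with n h1 h2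
  have e : Complex.logTaylor 3 (u n) = u n - u n ^ 2 / 2 := by
    simp [Complex.logTaylor_succ, Complex.logTaylor_zero]
    ring
  rw [e, show (1 : ℂ) - t * √(n : ℝ) * Complex.I / (n : ℝ) = 1 + u n by simp only [hu]; ring, ← h1]
  push_cast
  linear_combination (-1 / 2 : ℂ) * h2

lemma tendsto_charFun_gammaMeasure (c t : ℝ) :
    Tendsto (fun n : ℕ => charFun ((gammaMeasure (n + c) n).map fun x => √(n : ℝ) * (x - 1)) t)
      atTop (𝓝 (charFun (gaussianReal 0 1) t)) := by
  have h := (Complex.continuous_exp.tendsto _).comp (tendsto_exponent_gamma c t)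
  rw [charFun_gaussianReal]
  convert h.congr' ?_ using 2
  · simp
  · filter_upwards [tendsto_natCast_atTop_atTop.eventually_gt_atTop (-c),
      eventually_gt_atTop 0] with n hn hn0
    rw [charFun_map_sqrt_mul_sub_one, complexMGF_gammaMeasure (by linarith) (by exact_mod_cast hn0)
      (by simpa using hn0), ← Complex.exp_add]
    simp only [Function.comp_apply]
    push_cast
    ring_nf

/-! ### Marchenko–Pastur moments. -/

lemma catalan_succ_mul (n : ℕ) : (n + 2) * catalan (n + 1) = 2 * (2 * n + 1) * catalan n := by
  have h1 := succ_mul_catalan_eq_centralBinom n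
  have h2 := succ_mul_catalan_eq_centralBinom (n + 1)
  have h3 := Nat.succ_mul_centralBinom_succ n
  rw [← h1, ← h2] at h3
  apply Nat.eq_of_mul_eq_mul_left n.succ_pos
  rw [Nat.succ_eq_add_one]
  linarith

/-- Both sides have ratio `4 (i + 3/2) / (i + 3)` between consecutive indices. One of the factors
`4` comes from the dilation `x = 4u`, hence the exponent `i + 2`. -/
lemma four_pow_mul_beta_eq_catalan (i : ℕ) :
    4 ^ (i + 2) / (2 * Real.pi) * beta (i + 3 / 2) (3 / 2) = catalan (i + 1) := by
  have hg : Real.Gamma (3 / 2) = √Real.pi / 2 := by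
    rw [show (3 / 2 : ℝ) = 1 / 2 + 1 by norm_num, Real.Gamma_add_one (by norm_num),
      Real.Gamma_one_half_eq]
    ring
  induction i with
  | zero =>
    rw [beta, Nat.cast_zero, zero_add (3 / 2 : ℝ), hg, show (3 / 2 + 3 / 2 : ℝ) = (2 : ℕ) + 1 by norm_num,
      Real.Gamma_nat_eq_factorial]
    have := Real.mul_self_sqrt Real.pi_pos.le
    simp only [Nat.factorial, zero_add, catalan_one]
    have hpi := Real.pi_ne_zero
    field_simp
    push_cast
    nlinarith
  | succ i ih =>
    have hb : beta ((i + 1 : ℕ) + 3 / 2) (3 / 2) =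
        beta (i + 3 / 2) (3 / 2) * ((i + 3 / 2) / (i + 3)) := by
      rw [beta, beta, show (((i + 1 : ℕ) : ℝ) + 3 / 2) = (i + 3 / 2) + 1 by push_cast; ring,
        Real.Gamma_add_one (by positivity),
        show ((i : ℝ) + 3 / 2 + 1 + 3 / 2) = (i + 3 / 2 + 3 / 2) + 1 by ring,
        Real.Gamma_add_one (by positivity), show (i : ℝ) + 3 / 2 + 3 / 2 = i + 3 by ring]
      have := (Real.Gamma_pos_of_pos (show (0 : ℝ) < i + 3 by positivity)).ne'
      field_simp
    have hc : ((i : ℝ) + 3) * catalan (i + 1 + 1) = 2 * (2 * i + 3) * catalan (i + 1) := by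
      have := catalan_succ_mul (i + 1)
      have h' : (((i + 1 + 2) * catalan (i + 1 + 1) : ℕ) : ℝ) =
        ((2 * (2 * (i + 1) + 1) * catalan (i + 1) : ℕ) : ℝ) := by exact_mod_cast this
      push_cast at h'
      linarith
    have h3 : (i : ℝ) + 3 ≠ 0 := by positivity
    rw [hb]
    apply mul_left_cancel₀ h3
    rw [hc, ← ih]
    field_simp
    ring

lemma integrable_betaPDFReal {α β : ℝ} (hα : 0 < α) (hβ : 0 < β) :
    Integrable (betaPDFReal α β) := by
  refine ⟨by fun_prop, ?_⟩
  rw [hasFiniteIntegral_iff_ofReal]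
  · have := lintegral_betaPDF_eq_one hα hβ
    simp only [betaPDF] at this
    rw [this]
    exact ENNReal.one_lt_top
  · refine ae_of_all _ fun x => ?_
    by_cases hx : 0 < x ∧ x < 1
    · exact (betaPDFReal_pos hx.1 hx.2 hα hβ).le
    · simp [betaPDFReal, hx]

lemma integral_betaPDFReal {α β : ℝ} (hα : 0 < α) (hβ : 0 < β) : ∫ x, betaPDFReal α β x = 1 := by
  rw [integral_eq_lintegral_of_nonneg_ae]
  · have := lintegral_betaPDF_eq_one hα hβ
    simp only [betaPDF] at this
    rw [this, ENNReal.toReal_one]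
  · refine ae_of_all _ fun x => ?_
    by_cases hx : 0 < x ∧ x < 1
    · exact (betaPDFReal_pos hx.1 hx.2 hα hβ).le
    · simp [betaPDFReal, hx]
  · fun_prop

lemma marchenkoPastur_density_mul_pow (i : ℕ) (x : ℝ) :
    (Set.Ioo (0 : ℝ) 4).indicator (fun x => √(x * (4 - x)) / (2 * Real.pi * x)) x * x ^ (i + 1) =
      4 ^ (i + 1) / (2 * Real.pi) * beta (i + 3 / 2) (3 / 2) *
        betaPDFReal (i + 3 / 2) (3 / 2) (x / 4) := by
  by_cases hx : x ∈ Set.Ioo (0 : ℝ) 4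
  · obtain ⟨h0, h4⟩ := hx
    rw [Set.indicator_of_mem (Set.mem_Ioo.2 ⟨h0, h4⟩), betaPDFReal, if_pos ⟨by positivity, by linarith⟩]
    have hb := (beta_pos (α := i + 3 / 2) (β := 3 / 2) (by positivity) (by norm_num)).ne'
    have hxr : (x / 4) ^ ((i : ℝ) + 3 / 2 - 1) = (x / 4) ^ i * √(x / 4) := by
      rw [show (i : ℝ) + 3 / 2 - 1 = i + 1 / 2 by ring, Real.rpow_add (by positivity),
        Real.rpow_natCast, Real.sqrt_eq_rpow]
    have hyr : (1 - x / 4) ^ ((3 / 2 : ℝ) - 1) = √(1 - x / 4) := by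
      rw [Real.sqrt_eq_rpow]; norm_num
    have hs : √(x * (4 - x)) = 4 * (√(x / 4) * √(1 - x / 4)) := by
      rw [← Real.sqrt_mul (by positivity), show x * (4 - x) = 4 ^ 2 * (x / 4 * (1 - x / 4)) by ring,
        Real.sqrt_mul (by norm_num), Real.sqrt_sq (by norm_num)]
    rw [hxr, hyr, hs, div_pow]
    generalize beta (i + 3 / 2) (3 / 2) = b at hb
    have hpi := Real.pi_ne_zero
    field_simp
    ring
  · have : ¬ (0 < x / 4 ∧ x / 4 < 1) := fun h => hx ⟨by linarith [h.1], by linarith [h.2]⟩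
    rw [Set.indicator_of_notMem hx, betaPDFReal, if_neg this]
    simp

lemma integrable_pow_marchenkoPastur_and_integral_eq (i : ℕ) :
    Integrable (fun x : ℝ => x ^ (i + 1)) marchenkoPastur ∧
      ∫ x, x ^ (i + 1) ∂marchenkoPastur = catalan (i + 1) := by
  have hm : Measurable fun x : ℝ => ENNReal.ofReal
      ((Set.Ioo (0 : ℝ) 4).indicator (fun x => √(x * (4 - x)) / (2 * Real.pi * x)) x) :=
    ((Measurable.indicator (by fun_prop) measurableSet_Ioo)).ennreal_ofReal
  have hnn (x : ℝ) :
      0 ≤ (Set.Ioo (0 : ℝ) 4).indicator (fun x => √(x * (4 - x)) / (2 * Real.pi * x)) x := by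
    refine Set.indicator_nonneg (fun y hy => ?_) x
    have := hy.1
    positivity
  have hα : (0 : ℝ) < i + 3 / 2 := by positivity
  have hβ : (0 : ℝ) < 3 / 2 := by norm_num
  have hlt : ∀ᵐ x : ℝ, ENNReal.ofReal
      ((Set.Ioo (0 : ℝ) 4).indicator (fun x => √(x * (4 - x)) / (2 * Real.pi * x)) x) < ⊤ :=
    ae_of_all _ fun x => ENNReal.ofReal_lt_top
  rw [marchenkoPastur, integrable_withDensity_iff_integrable_smul' hm hlt,
    integral_withDensity_eq_integral_toReal_smul hm hlt]
  simp only [ENNReal.toReal_ofReal (hnn _), smul_eq_mul, marchenkoPastur_density_mul_pow]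
  refine ⟨((integrable_betaPDFReal hα hβ).comp_div (by norm_num)).const_mul _, ?_⟩
  rw [integral_const_mul, Measure.integral_comp_div (fun x => betaPDFReal (i + 3 / 2) (3 / 2) x),
    integral_betaPDFReal hα hβ, ← four_pow_mul_beta_eq_catalan]
  rw [abs_of_pos (by norm_num : (0 : ℝ) < 4), smul_eq_mul]
  ring

lemma marchenkoPasturMoments_eq (k : ℕ) (i : Fin k) :
    marchenkoPasturMoments k i = stieltjesMoment (fun _ => 1) (i + 1) := by
  rw [marchenkoPasturMoments, (integrable_pow_marchenkoPastur_and_integral_eq i).2,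
    stieltjesMoment_one]

/-! ### Delta method by an exact factorisation. -/

lemma matrixC_det (k : ℕ) : (matrixC k).det = 1 := by
  rw [Matrix.det_of_isLowerTriangular]
  · exact Finset.prod_eq_one fun i _ => by simp [matrixC]
  · intro i j hij
    have hij' : i < j := hij
    rw [matrixC, if_neg hij'.ne', if_neg hij'.not_gt]

/-- The matrix of difference quotients of the moments at the constant coordinates `1`. -/
def quotientMatrix (k : ℕ) (y : Fin k → ℝ) : Matrix (Fin k) (Fin k) ℝ :=
  fun i j => pathQuotient j (zeroExtend y) (2 * (i + 1)) 0

lemma quotientMatrix_zero (k : ℕ) : quotientMatrix k 0 = matrixC k := by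
  ext i j
  rw [← pathQuotient_zero_eq_matrixC, quotientMatrix]
  congr 1
  ext l
  simp [zeroExtend]

lemma continuous_zeroExtend (k : ℕ) : Continuous (zeroExtend : (Fin k → ℝ) → ℕ → ℝ) := by
  refine continuous_pi fun j => ?_
  by_cases hj : j < k
  · simp only [zeroExtend, hj, dif_pos]
    fun_prop
  · simp only [zeroExtend, hj, dif_neg, not_false_eq_true]
    fun_prop

lemma continuous_quotientMatrix (k : ℕ) : Continuous (quotientMatrix k) :=
  continuous_pi fun i => continuous_pi fun j =>
    (continuous_pathQuotient j (2 * (i + 1)) 0).comp (continuous_zeroExtend k)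

lemma firstCoords_stieltjesMap_sub {k n : ℕ} (hkn : k ≤ n) (z : Fin n → ℝ) (y : Fin k → ℝ)
    (hy : ∀ i, y i = z (Fin.castLE hkn i) - 1) :
    firstCoords k (stieltjesMap n z) - marchenkoPasturMoments k =
      (quotientMatrix k y).mulVec y := by
  ext i
  have h1 : stieltjesMoment (zeroExtend z) (i + 1) =
      stieltjesMoment (fun j => 1 + zeroExtend y j) (i + 1) := by
    refine stieltjesMoment_congr _ fun j hj => ?_
    have hjk : j < k := by omega
    simp only [zeroExtend, hjk, hjk.trans_le hkn, dif_pos, hy]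
    simp [Fin.castLE]
  rw [Pi.sub_apply, marchenkoPasturMoments_eq, firstCoords, dif_pos (i.2.trans_le hkn), stieltjesMap,
    h1, stieltjesMoment, stieltjesMoment, pathWeight_one_add_sub (zeroExtend y) _ _ k
      (fun j hj => by simp [zeroExtend, hj]), Matrix.mulVec, dotProduct,
    ← Fin.sum_univ_eq_sum_range (fun j => pathQuotient j (zeroExtend y) _ 0 * zeroExtend y j)]
  simp only [zeroExtend_val, quotientMatrix]

lemma continuous_firstCoords (k n : ℕ) :
    Continuous (firstCoords k : (Fin n → ℝ) → Fin k → ℝ) := by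
  refine continuous_pi fun i => ?_
  by_cases hi : (i : ℕ) < n
  · simp only [firstCoords, hi, dif_pos]
    fun_prop
  · simp only [firstCoords, hi, dif_neg, not_false_eq_true]
    fun_prop

lemma continuous_toLp_mulVec_firstCoords (k n : ℕ) :
    Continuous fun m : Fin n → ℝ => WithLp.toLp 2 (√(n : ℝ) •
      (matrixC k)⁻¹.mulVec (firstCoords k m - marchenkoPasturMoments k)) := by
  have h1 : Continuous fun m : Fin n → ℝ => firstCoords k m - marchenkoPasturMoments k :=
    (continuous_firstCoords k n).sub continuous_const
  have h2 : Continuous fun m : Fin n → ℝ =>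
      √(n : ℝ) • (matrixC k)⁻¹.mulVec (firstCoords k m - marchenkoPasturMoments k) :=
    (continuous_const.matrix_mulVec h1).const_smul (√(n : ℝ))
  exact (PiLp.continuous_toLp 2 _).comp h2

/-- The normalised fluctuation of the moments as a function of the fluctuation `p.1` of the
canonical coordinates and of the scale `p.2`. -/
noncomputable def momentFluctuation (k : ℕ) (p : (Fin k → ℝ) × ℝ) : EuclideanSpace ℝ (Fin k) :=
  WithLp.toLp 2 ((matrixC k)⁻¹.mulVec ((quotientMatrix k (p.2 • p.1)).mulVec p.1))

lemma continuous_momentFluctuation (k : ℕ) : Continuous (momentFluctuation k) := by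
  refine (PiLp.continuous_toLp 2 _).comp ?_
  exact continuous_const.matrix_mulVec (((continuous_quotientMatrix k).comp
    (continuous_snd.smul continuous_fst)).matrix_mulVec continuous_fst)

lemma momentFluctuation_zero (k : ℕ) (w : Fin k → ℝ) :
    momentFluctuation k (w, 0) = WithLp.toLp 2 w := by
  rw [momentFluctuation, zero_smul, quotientMatrix_zero, Matrix.mulVec_mulVec,
    Matrix.nonsing_inv_mul _ (by rw [matrixC_det]; exact isUnit_one), Matrix.one_mulVec]

/-- With `w = √n y`, the factorisation gives `√n Q(y) y = Q(w/√n) w`, an exact identity for each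
`n`. -/
lemma momentFluctuation_eq {k n : ℕ} (hkn : k ≤ n) (hn : 0 < n) (z : Fin n → ℝ) :
    momentFluctuation k (fun i => √(n : ℝ) * (z (Fin.castLE hkn i) - 1), (√(n : ℝ))⁻¹) =
      WithLp.toLp 2 (√(n : ℝ) • (matrixC k)⁻¹.mulVec
        (firstCoords k (stieltjesMap n z) - marchenkoPasturMoments k)) := by
  have hs : √(n : ℝ) ≠ 0 := (Real.sqrt_pos.2 (by exact_mod_cast hn)).ne'
  have e : (fun i => √(n : ℝ) * (z (Fin.castLE hkn i) - 1)) =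
      √(n : ℝ) • fun i => z (Fin.castLE hkn i) - 1 := rfl
  rw [firstCoords_stieltjesMap_sub hkn z _ fun i => rfl, momentFluctuation, e]
  simp only [inv_smul_smul₀ hs, Matrix.mulVec_smul]

/-! ### Convergence of the laws. -/

lemma map_pi_comp_injective {k n : ℕ} {μ : Fin n → Measure ℝ} [∀ i, IsProbabilityMeasure (μ i)]
    {e : Fin k → Fin n} (he : e.Injective) {f : ℝ → ℝ} (hf : Measurable f) :
    (Measure.pi μ).map (fun z i => f (z (e i))) = Measure.pi fun i => (μ (e i)).map f := by
  have h1 : iIndepFun (fun i (z : Fin n → ℝ) => f (z i)) (Measure.pi μ) :=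
    iIndepFun_pi (X := fun _ => f) fun _ => hf.aemeasurable
  have h2 := (iIndepFun_iff_map_fun_eq_pi_map fun i =>
    (hf.comp (measurable_pi_apply (e i))).aemeasurable).1 (h1.precomp he)
  refine h2.trans ?_
  congr 1
  ext1 i
  rw [← (measurePreserving_eval μ (e i)).map_eq, Measure.map_map hf (measurable_pi_apply _)]

/-- The law of the normalised fluctuation of a gamma variable with shape `n + c` and rate `n`. -/
noncomputable def gammaFluctuation (c : ℝ) (n : ℕ) : Measure ℝ :=
  (gammaMeasure (n + c) n).map fun x => √(n : ℝ) * (x - 1)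

lemma isProbabilityMeasure_gammaFluctuation {c : ℝ} {n : ℕ} (hn : 0 < n) (hc : 0 < n + c) :
    IsProbabilityMeasure (gammaFluctuation c n) := by
  have := isProbabilityMeasure_gammaMeasure hc (show (0 : ℝ) < n by exact_mod_cast hn)
  exact Measure.isProbabilityMeasure_map (by fun_prop)

lemma map_momentLaw_eq {γ : ℕ → ℝ} (hγ : ∀ k, 1 ≤ k → -1 < γ k) {k n : ℕ} (hkn : k ≤ n)
    (hn : 0 < n) :
    (momentLaw n γ fun _ => (n : ℝ)).map (fun m => WithLp.toLp 2 (√(n : ℝ) •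
        (matrixC k)⁻¹.mulVec (firstCoords k m - marchenkoPasturMoments k))) =
      ((Measure.pi fun i : Fin k => gammaFluctuation (γ (i + 1) - i) n).prod
        (Measure.dirac (√(n : ℝ))⁻¹)).map (momentFluctuation k) := by
  have hn' : (0 : ℝ) < n := by exact_mod_cast hn
  have hpos (i : Fin n) : 0 < γ (i + 1) + n - (i + 1 : ℕ) + 1 := by
    have h1 := hγ (i + 1) (by omega)
    have h2 : (((i : ℕ) + 1 : ℕ) : ℝ) ≤ n := by exact_mod_cast i.2
    linarith
  have hprob (i : Fin n) := isProbabilityMeasure_gammaMeasure (hpos i) hn'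
  have hmap := map_pi_comp_injective (μ := fun i : Fin n =>
    gammaMeasure (γ (i + 1) + n - (i + 1 : ℕ) + 1) (n : ℝ)) (Fin.castLE_injective hkn)
    (f := fun x => √(n : ℝ) * (x - 1)) (by fun_prop)
  have hpi : (Measure.pi fun i : Fin k => gammaFluctuation (γ (i + 1) - i) n) =
      (Measure.pi fun i : Fin n => gammaMeasure (γ (i + 1) + n - (i + 1 : ℕ) + 1) (n : ℝ)).map
        fun z i => √(n : ℝ) * (z (Fin.castLE hkn i) - 1) := by
    rw [hmap]
    congr 1
    ext1 i
    rw [gammaFluctuation]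
    congr 2
    simp only [Fin.val_castLE]
    push_cast
    ring
  rw [momentLaw_eq_map_pi_gammaMeasure hpos fun _ => hn', hpi,
    Measure.map_map (continuous_toLp_mulVec_firstCoords k n).measurable
      (differentiable_stieltjesMap n).continuous.measurable]
  have hw : Measurable fun (z : Fin n → ℝ) (i : Fin k) => √(n : ℝ) * (z (Fin.castLE hkn i) - 1) := by
    fun_prop
  have := Measure.isProbabilityMeasure_map (μ := Measure.pi fun i : Fin n =>
    gammaMeasure (γ (i + 1) + n - (i + 1 : ℕ) + 1) (n : ℝ))
    hw.aemeasurable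
  rw [Measure.prod_dirac, Measure.map_map (continuous_momentFluctuation k).measurable (by fun_prop),
    Measure.map_map ((continuous_momentFluctuation k).measurable.comp (by fun_prop)) hw]
  congr 1
  ext1 z
  exact (momentFluctuation_eq hkn hn z).symm

/-- The deterministic scale enters as a Dirac factor, so joint convergence is convergence of product
measures and no separate Slutsky argument is needed. -/
lemma tendsto_map_momentFluctuation {k : ℕ} {ν : ℕ → Fin k → ProbabilityMeasure ℝ} {s : ℕ → ℝ}
    (hν : ∀ i, Tendsto (fun n => ν n i) atTop (𝓝 ⟨gaussianReal 0 1, inferInstance⟩))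
    (hs : Tendsto s atTop (𝓝 0)) :
    Tendsto (fun n => ((ProbabilityMeasure.pi (ν n)).prod (diracProba (s n))).map
      (continuous_momentFluctuation k).measurable.aemeasurable) atTop
      (𝓝 ⟨multivariateGaussian 0 (1 : Matrix (Fin k) (Fin k) ℝ), inferInstance⟩) := by
  have h1 := (ProbabilityMeasure.continuous_pi (α := fun _ : Fin k => ℝ)).tendsto
    (fun _ => ⟨gaussianReal 0 1, inferInstance⟩) |>.comp (tendsto_pi_nhds.2 hν)
  have h2 := (continuous_diracProba.tendsto (0 : ℝ)).comp hs
  have h3 := (ProbabilityMeasure.continuous_prod.tendsto _).comp (h1.prodMk_nhds h2)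
  have h4 := ProbabilityMeasure.tendsto_map_of_tendsto_of_continuous _ _ h3
    (continuous_momentFluctuation k)
  convert! h4 using 1
  refine congrArg 𝓝 (Subtype.ext ?_)
  change multivariateGaussian 0 1 =
    Measure.map _ (Measure.prod (Measure.pi fun _ => gaussianReal 0 1) (Measure.dirac 0))
  rw [Measure.prod_dirac, Measure.map_map (continuous_momentFluctuation k).measurable
    (by fun_prop), multivariateGaussian_zero_one, ← map_pi_eq_stdGaussian]
  congr 1
  ext1 w
  exact (momentFluctuation_zero k w).symm

theorem mainTheorem1
    (γ : ℕ → ℝ) (hγ : ∀ k, 1 ≤ k → -1 < γ k)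
    {Ω : ℕ → Type*} [∀ n, MeasurableSpace (Ω n)]
    (P : ∀ n, Measure (Ω n)) [∀ n, IsProbabilityMeasure (P n)]
    (M : ∀ n, Ω n → (Fin n → ℝ))
    (hM : ∀ n, HasLaw (M n) (momentLaw n γ (fun _ => (n : ℝ))) (P n))
    (k : ℕ) :
    (∀ i : Fin k, Integrable (fun x : ℝ => x ^ ((i : ℕ) + 1)) marchenkoPastur ∧
      marchenkoPasturMoments k i = (catalan ((i : ℕ) + 1) : ℝ)) ∧
    TendstoInDistribution
      (fun (n : ℕ) (ω : Ω n) => WithLp.toLp 2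
        (√(n : ℝ) • (matrixC k)⁻¹.mulVec (firstCoords k (M n ω) - marchenkoPasturMoments k)))
      Filter.atTop
      (id : EuclideanSpace ℝ (Fin k) → EuclideanSpace ℝ (Fin k))
      P
      (multivariateGaussian 0 (1 : Matrix (Fin k) (Fin k) ℝ)) := by
  refine ⟨fun i => integrable_pow_marchenkoPastur_and_integral_eq i, ?_⟩
  refine ⟨fun n => (continuous_toLp_mulVec_firstCoords k n).measurable.comp_aemeasurable
    (hM n).aemeasurable, aemeasurable_id, ?_⟩
  -- Shifting the index by `k + 1` ensures `k ≤ n`, `n > 0` and positive shape parameters, so that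
  -- all laws below are probability measures.
  have hpos (m : ℕ) (i : Fin k) : 0 < ((m + (k + 1) : ℕ) : ℝ) + (γ (i + 1) - i) := by
    have h1 := hγ (i + 1) (by omega)
    have h2 : ((i : ℕ) : ℝ) ≤ k := by exact_mod_cast i.2.le
    have h3 : (0 : ℝ) ≤ m := Nat.cast_nonneg m
    push_cast
    linarith
  have hprob (m : ℕ) (i : Fin k) :=
    isProbabilityMeasure_gammaFluctuation (n := m + (k + 1)) (by omega) (hpos m i)
  have hlim := tendsto_map_momentFluctuation (k := k)
    (ν := fun m i => ⟨gammaFluctuation (γ (i + 1) - i) (m + (k + 1)), hprob m i⟩)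
    (s := fun m => (√((m + (k + 1) : ℕ) : ℝ))⁻¹)
    (fun i => ProbabilityMeasure.tendsto_iff_tendsto_charFun.2 fun t =>
      (tendsto_charFun_gammaMeasure (γ (i + 1) - i) t).comp (tendsto_add_atTop_nat (k + 1)))
    (tendsto_inv_atTop_zero.comp (Real.tendsto_sqrt_atTop.comp
      (tendsto_natCast_atTop_atTop.comp (tendsto_add_atTop_nat (k + 1)))))
  refine (tendsto_add_atTop_iff_nat (k + 1)).1 ?_
  convert! hlim using 1
  · congr 1
    funext m
    refine Subtype.ext ?_
    have h1 := map_momentLaw_eq hγ (k := k) (n := m + (k + 1)) (by omega) (by omega)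
    rw [← (hM (m + (k + 1))).map_eq, AEMeasurable.map_map_of_aemeasurable
      (continuous_toLp_mulVec_firstCoords _ _).aemeasurable (hM _).aemeasurable] at h1
    exact h1
  · exact congrArg 𝓝 (Subtype.ext Measure.map_id)
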